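/- Let $D=\{z\in\mathbb R^2 : |z|<1\}$ be the unit disk, with boundary the unit circle $S^1$. For distinct $P,Q\in D$ let $v_1,v_2\in S^1$ be the two points in which the line $PQ$ meets $S^1$, and define the Beltrami–Klein distance $$d'(P,Q)=\frac12\left|\log\frac{|v_1Q|\,|v_2P|}{|v_1P|\,|v_2Q|}\right|,\qquad d'(P,P)=0.$$ For an integer $n\ge 1$ and distinct $P,Q\in D$ put $$\Delta_n'(P,Q)=\log\frac{e^{n\,d'(P,Q)}+1}{e^{n\,d'(P,Q)}-1},$$ and for $R\in D$ let $\delta(P,Q,R)$ be the minimum of $d'(R,S)$ over the points $S\in D$ of the line $PQ$. For a nonempty compact convex set $U\subset D$ and $v\in S^1$, let $\psi_U(v)\in S^1$ be the first point $w\neq v$, counterclockwise from $v$, such that the line $vw$ is tangent to (i.e. a supporting line of) $U$. Precisely, let $\mathcal R(v)$ be $v$ rotated counterclockwise by a right angle, and let $\theta(v)$ be the minimum over $u\in U$ of the gradient of the line $uv$ in the coordinates given by the basis $\{v,\mathcal R(v)\}$; then $\psi_U(v)$ is the second intersection of $S^1$ with the line through $v$ whose gradient in this basis is $\theta(v)$.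 Identify $S^1$ with $\mathbb R/\mathbb Z$. For an orientation-preserving homeomorphism $f$ of $S^1$ let $\overline f:\mathbb R\to\mathbb R$ be its lift with $\overline f(0)\in[0,1)$; the rotation number of $f$ is $\rho(f)=\lim_{n\to\infty}\bigl(\overline f^{\,n}(x)-x\bigr)/n$, which exists and does not depend on $x\in\mathbb R$. **Theorem.** Let $P,Q,R\in D$ be the vertices of a (non-degenerate) triangle $\triangle PQR$, regarded as a closed convex set. Suppose that $$\Delta_2'(P,Q)\le\delta(P,Q,R)\le\tfrac12\Delta_1'(P,Q)\quad\text{or}\quad \tfrac12\Delta_1'(P,Q)\le\delta(P,Q,R)\le\Delta_2'(P,Q).$$ Then $\psi_{\triangle PQR}$ is an orientation-preserving homeomorphism of $S^1$ and $\rho(\psi_{\triangle PQR})=\frac25$. -/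

import Mathlib

/-!
The plane `ℝ²` is identified with `ℂ` (with its Euclidean norm and real inner product),
the open unit disk `D` is `{z | ‖z‖ < 1}`, the unit circle `S¹` is `Circle`, and
`x ↦ Circle.exp (2 * π * x)` is the covering map `ℝ → ℝ/ℤ = S¹`.
-/

noncomputable section

namespace BarBilliard

/-! ### The Beltrami–Klein model -/

/-- The parameter of the point at infinity in which the ray from `P` through `Q` leaves the disk:
the nonnegative root `s` of `‖P + s (Q - P)‖ = 1`. -/
def exitParam (P Q : ℂ) : ℝ :=
  (-inner ℝ P (Q - P) + Real.sqrt (inner ℝ P (Q - P) ^ 2 + ‖Q - P‖ ^ 2 * (1 - ‖P‖ ^ 2)))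
    / ‖Q - P‖ ^ 2

/-- For distinct `P, Q` in the disk, the point of the unit circle in which the ray from `P`
through `Q` leaves the disk. The line `PQ` meets the circle in `exitPoint Q P` and
`exitPoint P Q`. -/
def exitPoint (P Q : ℂ) : ℂ := P + (exitParam P Q : ℂ) * (Q - P)

theorem norm_exitPoint {P Q : ℂ} (hP : ‖P‖ < 1) (hPQ : P ≠ Q) : ‖exitPoint P Q‖ = 1 := by
  have hn : ‖Q - P‖ ≠ 0 := norm_ne_zero_iff.2 (sub_ne_zero.2 hPQ.symm)
  have hP2 : 0 ≤ 1 - ‖P‖ ^ 2 := by nlinarith [norm_nonneg P]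
  have hdisc : 0 ≤ inner ℝ P (Q - P) ^ 2 + ‖Q - P‖ ^ 2 * (1 - ‖P‖ ^ 2) := by positivity
  have hsq := Real.sq_sqrt hdisc
  have key : ‖exitPoint P Q‖ ^ 2 = 1 := by
    have e : exitPoint P Q = P + exitParam P Q • (Q - P) := by simp [exitPoint]
    rw [e, norm_add_sq_real, inner_smul_right, norm_smul, mul_pow, Real.norm_eq_abs, sq_abs]
    simp only [exitParam]
    field_simp
    linear_combination hsq
  have h0 := norm_nonneg (exitPoint P Q)
  nlinarith

/-- The point at infinity lies beyond `Q` on the ray from `P` through `Q`. -/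
theorem one_lt_exitParam {P Q : ℂ} (hQ : ‖Q‖ < 1) (hPQ : P ≠ Q) :
    1 < exitParam P Q := by
  have hn : 0 < ‖Q - P‖ ^ 2 := by
    have : 0 < ‖Q - P‖ := norm_pos_iff.2 (sub_ne_zero.2 hPQ.symm)
    positivity
  have hQ2 : ‖Q‖ ^ 2 < 1 := by nlinarith [norm_nonneg Q]
  have e : ‖Q‖ ^ 2 = ‖P‖ ^ 2 + 2 * inner ℝ P (Q - P) + ‖Q - P‖ ^ 2 := by
    rw [← norm_add_sq_real]
    simp
  rw [exitParam, lt_div_iff₀ hn]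
  have : ‖Q - P‖ ^ 2 + inner ℝ P (Q - P) <
      Real.sqrt (inner ℝ P (Q - P) ^ 2 + ‖Q - P‖ ^ 2 * (1 - ‖P‖ ^ 2)) := by
    apply Real.lt_sqrt_of_sq_lt
    nlinarith
  linarith

/-- The Beltrami–Klein distance `d'(P, Q) = ½ |log (|v₁Q| |v₂P| / (|v₁P| |v₂Q|))|`, where
`v₁, v₂` are the points at infinity of the line `PQ`; it is `0` for `P = Q`. -/
def kleinDist (P Q : ℂ) : ℝ :=
  if P = Q then 0
  else 1 / 2 * |Real.log
    ((dist (exitPoint Q P) Q * dist (exitPoint P Q) P) /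
      (dist (exitPoint Q P) P * dist (exitPoint P Q) Q))|

/-- `Δₙ'(P, Q) = log ((e^{n d'(P,Q)} + 1) / (e^{n d'(P,Q)} - 1))`. -/
def Delta (n : ℕ) (P Q : ℂ) : ℝ :=
  Real.log ((Real.exp (n * kleinDist P Q) + 1) / (Real.exp (n * kleinDist P Q) - 1))

/-- `δ(P, Q, R)`: the least distance from `R` to a point `S` of the hyperbolic line `PQ`. -/
def lineDist (P Q R : ℂ) : ℝ :=
  sInf {d : ℝ | ∃ S : ℂ, S ∈ line[ℝ, P, Q] ∧ ‖S‖ < 1 ∧ d = kleinDist R S}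

/-! ### The bar-billiard map -/

/-- The gradient of the line through `u` and `v` in the coordinates given by the basis
`{v, R v}`, where `R v = i v` is `v` rotated counterclockwise by a right angle. -/
def lineGradient (u v : ℂ) : ℝ :=
  inner ℝ (Complex.I * v) (u - v) / inner ℝ v (u - v)

/-- The least gradient of a line joining `v` to a point of `U`. For `v ∈ S¹` and `U` compact in the
open disk, this is the gradient of the first supporting line of `U` through `v`, i.e. the
one whose other end on the circle comes first counterclockwise from `v`. -/
def minGradient (U : Set ℂ) (v : ℂ) : ℝ := sInf ((fun u => lineGradient u v) '' U)

/-- The bar-billiard map `ψ_U` of `S¹`: the point `ψ_U v` is the second intersection of the unit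
circle with the line through `v` of gradient `minGradient U v` in the basis `{v, R v}`. -/
def psi (U : Set ℂ) (v : Circle) : Circle :=
  ⟨(⟨0, 1⟩ : EuclideanGeometry.Sphere ℂ).secondInter (v : ℂ)
      ((v : ℂ) + (minGradient U v : ℂ) * (Complex.I * v)), by
    refine mem_sphere_zero_iff_norm.2 ?_
    rw [← dist_zero_right]
    exact (EuclideanGeometry.Sphere.secondInter_dist ⟨0, 1⟩ _ _).trans (by simpa using Circle.norm_coe v)⟩

/-! ### Rotation numbers -/

/-- `F` is the lift of `f` to `ℝ`, normalised by `F 0 ∈ [0, 1)`, and witnesses that `f` is an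
orientation-preserving homeomorphism of the circle. -/
structure IsNormalizedLift (f : Circle → Circle) (F : ℝ → ℝ) : Prop where
  continuous : Continuous F
  strictMono : StrictMono F
  map_add_one : ∀ x, F (x + 1) = F x + 1
  semiconj : ∀ x, Circle.exp (2 * Real.pi * F x) = f (Circle.exp (2 * Real.pi * x))
  map_zero_mem : F 0 ∈ Set.Ico (0 : ℝ) 1

/-- `f` is an orientation-preserving homeomorphism of the circle whose rotation number
`lim (Fⁿ x - x) / n` (for every `x`, with `F` the normalised lift) exists and equals `ρ`. -/
def HasRotationNumber (f : Circle → Circle) (ρ : ℝ) : Prop :=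
  ∃ F : ℝ → ℝ, IsNormalizedLift f F ∧
    ∀ x : ℝ, Filter.Tendsto (fun n : ℕ => (F^[n] x - x) / n) Filter.atTop (nhds ρ)

end BarBilliard

end

/-!
Along the double cover `z ↦ z²` of the circle, the involution exchanging the ends of the chords
through a point `X` of the disk lifts to a real linear map `spinMap X` of the plane, so the order of
points of an orbit is read off the sign of a determinant. The bar-billiard map of a triangle is the
same as that of its vertex set, and its lift `F` to `ℝ` is the minimum of the lifts of the three
vertex involutions.

The rotation number is `2/5` as soon as `F⁵ t - (t + 2)` takes both signs. Following the orbits of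
the two ends of the chord `PQ`, the lift `F⁵` carries one explicit point to the translate by `2` of
another, and comparing `δ` with `Δ₁' / 2` compares these two points. On the other side, writing a
vertex for its lifted involution, `F⁵ t ≤ RQPQP t`, and `Δ₂' ≤ δ` says that the linear lift of
`RQPQP` has nonnegative discriminant, hence a positive eigenvalue, whose eigenvector solves
`RQPQP t = t + 2`. Finally, `δ ≤ Δ₂'` implies the `Δ₁'` inequality for the relabelled triangle
`QRP`, since `sinh d'(P, Q) sinh δ(P, Q, R)` depends only on the triangle.
-/

noncomputable section

namespace BarBilliard

open Complex ComplexConjugate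

/-! ### The circle, its double cover and chords -/

/-- The determinant `u × v` of two plane vectors. -/
def cross (u v : ℂ) : ℝ := u.re * v.im - u.im * v.re

theorem cross_self (u : ℂ) : cross u u = 0 := by
  rw [cross, mul_comm, sub_self]

theorem cross_anticomm (u v : ℂ) : cross u v = -cross v u := by
  simp only [cross]; ring

theorem cross_mul_cross_sub (u v z w : ℂ) :
    cross u z * cross v w - cross u w * cross v z = cross u v * cross z w := by
  simp only [cross]; ring

theorem cross_smul_add_smul (α β γ δ : ℝ) (u v : ℂ) :
    cross (α • u + β • v) (γ • u + δ • v) = (α * δ - β * γ) * cross u v := by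
  simp [cross]; ring

theorem cross_smul_left (r : ℝ) (u v : ℂ) : cross (r • u) v = r * cross u v := by
  simp [cross]; ring

theorem cross_smul_right (r : ℝ) (u v : ℂ) : cross u (r • v) = r * cross u v := by
  simp [cross]; ring

theorem exists_smul_eq_of_cross_eq_zero {u v : ℂ} (hu : u ≠ 0) (h : cross u v = 0) :
    ∃ r : ℝ, v = r • u := by
  have him : (v / u).im = 0 := by
    rw [div_im, div_sub_div_same, div_eq_zero_iff, ← h, cross]
    left; ring
  refine ⟨(v / u).re, ?_⟩
  rw [real_smul, conj_eq_iff_re.1 (conj_eq_iff_im.2 him), div_mul_cancel₀ v hu]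

/-- The Lorentzian product `1 - ⟨X, Y⟩` of the points `(1, X)` and `(1, Y)` of Minkowski space, in
which the disk is the projectivised cone of timelike vectors. -/
def lorentz (X Y : ℂ) : ℝ := 1 - inner ℝ X Y

theorem lorentz_eq (X Y : ℂ) : lorentz X Y = 1 - (X.re * Y.re + X.im * Y.im) := by
  simp [lorentz, Complex.inner]; ring

theorem lorentz_comm (X Y : ℂ) : lorentz X Y = lorentz Y X := by
  rw [lorentz, real_inner_comm, lorentz]

theorem lorentz_self (X : ℂ) : lorentz X X = 1 - ‖X‖ ^ 2 := by
  rw [lorentz, real_inner_self_eq_norm_sq]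

theorem lorentz_self_pos {X : ℂ} : 0 < lorentz X X ↔ ‖X‖ < 1 := by
  rw [lorentz_self, sub_pos, sq_lt_one_iff₀ (norm_nonneg X)]

theorem lorentz_pos {X Y : ℂ} (hX : ‖X‖ < 1) (hY : ‖Y‖ ≤ 1) : 0 < lorentz X Y := by
  have h : ‖X‖ * ‖Y‖ < 1 := mul_lt_one_of_nonneg_of_lt_one_left (norm_nonneg X) hX hY
  exact sub_pos.2 ((real_inner_le_norm X Y).trans_lt h)

theorem inner_sub_neg {X v : ℂ} (hX : ‖X‖ < 1) (hv : ‖v‖ = 1) : inner ℝ v (X - v) < 0 := by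
  have h := lorentz_pos hX hv.le
  rw [lorentz, real_inner_comm] at h
  rw [inner_sub_right, real_inner_self_eq_norm_sq, hv]
  linarith

/-- The unit vector `e^{iπt}`, a square root of the point of the circle with parameter `t`. -/
def spin (t : ℝ) : ℂ := Circle.exp (Real.pi * t)

theorem norm_spin (t : ℝ) : ‖spin t‖ = 1 := Circle.norm_coe _

theorem spin_ne_zero (t : ℝ) : spin t ≠ 0 := Circle.coe_ne_zero _

theorem spin_mul_conj (t : ℝ) : spin t * conj (spin t) = 1 := by
  rw [mul_conj, normSq_eq_norm_sq, norm_spin, one_pow, ofReal_one]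

theorem norm_spin_sq (t : ℝ) : ‖spin t ^ 2‖ = 1 := by rw [norm_pow, norm_spin, one_pow]

theorem coe_exp_two_pi_mul (t : ℝ) : (Circle.exp (2 * Real.pi * t) : ℂ) = spin t ^ 2 := by
  rw [mul_assoc, two_mul, Circle.exp_add, Circle.coe_mul, ← pow_two, spin]

theorem exp_two_pi_mul_add_one (t : ℝ) :
    Circle.exp (2 * Real.pi * (t + 1)) = Circle.exp (2 * Real.pi * t) := by
  rw [mul_add, mul_one, Circle.exp_add, Circle.exp_two_pi, mul_one]

theorem spin_add (s t : ℝ) : spin (s + t) = spin s * spin t := by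
  rw [spin, mul_add, Circle.exp_add, Circle.coe_mul, spin, spin]

theorem spin_one : spin 1 = -1 := by
  rw [spin, mul_one, Circle.coe_exp, exp_pi_mul_I]

theorem spin_half : spin (1 / 2) = I := by
  rw [spin, Circle.coe_exp, mul_one_div, ofReal_div, ofReal_ofNat, exp_pi_div_two_mul_I]

theorem spin_add_one (t : ℝ) : spin (t + 1) = -spin t := by
  rw [spin_add, spin_one, mul_neg_one]

theorem spin_re (t : ℝ) : (spin t).re = Real.cos (Real.pi * t) := by
  rw [spin, Circle.coe_exp, exp_ofReal_mul_I_re]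

theorem spin_im (t : ℝ) : (spin t).im = Real.sin (Real.pi * t) := by
  rw [spin, Circle.coe_exp, exp_ofReal_mul_I_im]

theorem spin_re_sq_add_im_sq (t : ℝ) : (spin t).re ^ 2 + (spin t).im ^ 2 = 1 := by
  rw [spin_re, spin_im, Real.cos_sq_add_sin_sq]

theorem cross_spin_spin (s t : ℝ) : cross (spin s) (spin t) = Real.sin (Real.pi * (t - s)) := by
  rw [mul_sub, Real.sin_sub, cross, spin_re, spin_re, spin_im, spin_im]
  ring

theorem cross_spin_spin_pos {s t : ℝ} (hst : s < t) (hts : t < s + 1) :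
    0 < cross (spin s) (spin t) := by
  rw [cross_spin_spin]
  apply Real.sin_pos_of_pos_of_lt_pi <;> nlinarith [Real.pi_pos]

theorem le_of_cross_spin_spin_nonneg {s t : ℝ} (hst : s < t + 1)
    (h : 0 ≤ cross (spin s) (spin t)) : s ≤ t := by
  by_contra! hts
  have := cross_spin_spin_pos hts hst
  rw [cross_anticomm] at this
  linarith

/-- `z` is a positive multiple of `spin t`. -/
def HasDirection (z : ℂ) (t : ℝ) : Prop := ∃ r : ℝ, 0 < r ∧ r • spin t = z

theorem hasDirection_spin (t : ℝ) : HasDirection (spin t) t := ⟨1, one_pos, one_smul ℝ _⟩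

theorem exists_hasDirection {z : ℂ} (hz : z ≠ 0) : ∃ t, HasDirection z t := by
  refine ⟨z.arg / Real.pi, ‖z‖, norm_pos_iff.2 hz, ?_⟩
  rw [spin, mul_div_cancel₀ _ Real.pi_ne_zero, Circle.coe_exp, real_smul, norm_mul_exp_arg_mul_I]

namespace HasDirection

variable {z w : ℂ} {s t : ℝ}

theorem smul (h : HasDirection z t) {r : ℝ} (hr : 0 < r) : HasDirection (r • z) t := by
  obtain ⟨ρ, hρ, rfl⟩ := h
  exact ⟨r * ρ, mul_pos hr hρ, mul_smul r ρ _⟩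

theorem neg (h : HasDirection z t) : HasDirection (-z) (t + 1) := by
  obtain ⟨r, hr, rfl⟩ := h
  exact ⟨r, hr, by rw [spin_add_one, smul_neg]⟩

theorem exists_eq_add_two_mul (hs : HasDirection z s) (ht : HasDirection z t) :
    ∃ n : ℤ, s = t + 2 * n := by
  obtain ⟨r, hr, rfl⟩ := hs
  obtain ⟨r', hr', h⟩ := ht
  have hrr' : r' = r := by
    simpa [norm_smul, norm_spin, abs_of_pos hr, abs_of_pos hr'] using congrArg norm h
  rw [hrr', smul_right_inj hr.ne'] at h
  obtain ⟨n, hn⟩ := Circle.exp_eq_exp.1 (Circle.ext h.symm)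
  refine ⟨n, mul_left_cancel₀ Real.pi_ne_zero ?_⟩
  rw [hn]; ring

theorem le_of_cross_nonneg (hz : HasDirection z s) (hw : HasDirection w t) (hst : s < t + 1)
    (h : 0 ≤ cross z w) : s ≤ t := by
  obtain ⟨r, hr, rfl⟩ := hz
  obtain ⟨r', hr', rfl⟩ := hw
  rw [cross_smul_left, cross_smul_right, ← mul_assoc] at h
  exact le_of_cross_spin_spin_nonneg hst (nonneg_of_mul_nonneg_right h (mul_pos hr hr'))

theorem eq_of_cross_eq_zero (hz : HasDirection z s) (hw : HasDirection w t) (hst : s < t + 1)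
    (hts : t < s + 1) (h : cross z w = 0) : s = t :=
  le_antisymm (hz.le_of_cross_nonneg hw hst h.ge)
    (hw.le_of_cross_nonneg hz hts (by rw [cross_anticomm, h, neg_zero]))

theorem lt_of_cross_pos (hz : HasDirection z s) (hw : HasDirection w t) (hst : s < t + 1)
    (h : 0 < cross z w) : s < t := by
  refine (hz.le_of_cross_nonneg hw hst h.le).lt_of_ne ?_
  rintro rfl
  obtain ⟨r, -, rfl⟩ := hz
  obtain ⟨r', -, rfl⟩ := hw
  simp only [cross_smul_left, cross_smul_right, cross_self, mul_zero, lt_irrefl] at h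

end HasDirection

/-- The real linear map of the plane that lifts, along the double cover `z ↦ z²` of the circle, the
involution exchanging the two ends of every chord through `X`. -/
def spinMap (X : ℂ) : ℂ →ₗ[ℝ] ℂ where
  toFun z := I * (z - X * conj z)
  map_add' z w := by rw [map_add]; ring
  map_smul' r z := by simp only [real_smul, map_mul, conj_ofReal, RingHom.id_apply]; ring

theorem spinMap_apply (X z : ℂ) : spinMap X z = I * (z - X * conj z) := rfl

theorem spinMap_re (X z : ℂ) : (spinMap X z).re = -z.im + (X.im * z.re - X.re * z.im) := by
  simp [spinMap_apply]; ring

theorem spinMap_im (X z : ℂ) : (spinMap X z).im = z.re - (X.re * z.re + X.im * z.im) := by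
  simp [spinMap_apply]

theorem spinMap_spinMap (X z : ℂ) : spinMap X (spinMap X z) = -(lorentz X X • z) := by
  apply Complex.ext <;> simp [spinMap_re, spinMap_im, lorentz_eq] <;> ring

theorem cross_spinMap_spinMap (X z w : ℂ) :
    cross (spinMap X z) (spinMap X w) = lorentz X X * cross z w := by
  simp only [cross, spinMap_re, spinMap_im, lorentz_eq]; ring

theorem cross_spinMap_comm (X z w : ℂ) : cross z (spinMap X w) = cross w (spinMap X z) := by
  simp only [cross, spinMap_re, spinMap_im]; ring

theorem cross_spin_spinMap_spin (X : ℂ) (t : ℝ) :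
    cross (spin t) (spinMap X (spin t)) = lorentz X (spin t ^ 2) := by
  simp only [cross, spinMap_re, spinMap_im, lorentz_eq, pow_two, mul_re, mul_im]
  linear_combination spin_re_sq_add_im_sq t

/-- If `t` is the parameter of a point `v` of the circle, then this is the parameter in `(t, t + 1)`
of the other end of the chord from `v` that has gradient `m` in the basis `{v, iv}`. -/
def gradientLift (m t : ℝ) : ℝ := t + 1 / 2 + Real.arctan m / Real.pi

theorem arctan_div_pi_mem (m : ℝ) : Real.arctan m / Real.pi ∈ Set.Ioo (-(1 / 2) : ℝ) (1 / 2) := by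
  have hpi := Real.pi_pos
  constructor
  · rw [lt_div_iff₀ hpi]; linarith [Real.neg_pi_div_two_lt_arctan m]
  · rw [div_lt_iff₀ hpi]; linarith [Real.arctan_lt_pi_div_two m]

theorem lt_gradientLift (m t : ℝ) : t < gradientLift m t := by
  rw [gradientLift]; linarith [(arctan_div_pi_mem m).1]

theorem gradientLift_lt_add_one (m t : ℝ) : gradientLift m t < t + 1 := by
  rw [gradientLift]; linarith [(arctan_div_pi_mem m).2]

theorem gradientLift_add_one (m t : ℝ) : gradientLift m (t + 1) = gradientLift m t + 1 := by
  simp only [gradientLift]; ring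

theorem monotone_gradientLift (t : ℝ) : Monotone fun m => gradientLift m t := fun _ _ h =>
  add_le_add_right (div_le_div_of_nonneg_right (Real.arctan_mono h) Real.pi_pos.le) _

theorem continuous_gradientLift : Continuous fun x : ℝ × ℝ => gradientLift x.1 x.2 := by
  unfold gradientLift
  fun_prop

theorem sqrt_smul_spin_arctan_div_pi (m : ℝ) :
    √(1 + m ^ 2) • spin (Real.arctan m / Real.pi) = 1 + m * I := by
  have hm : √(1 + m ^ 2) ≠ 0 := by positivity
  apply Complex.ext <;>
    simp [spin_re, spin_im, mul_div_cancel₀ _ Real.pi_ne_zero, Real.cos_arctan, Real.sin_arctan,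
      mul_div_cancel₀ _ hm, mul_inv_cancel₀ hm]

theorem sqrt_smul_spin_gradientLift (m t : ℝ) :
    √(1 + m ^ 2) • spin (gradientLift m t) = I * spin t * (1 + m * I) := by
  rw [gradientLift, spin_add, spin_add, spin_half, ← sqrt_smul_spin_arctan_div_pi, real_smul,
    real_smul]
  ring

theorem hasDirection_gradientLift (m t : ℝ) :
    HasDirection (I * spin t * (1 + m * I)) (gradientLift m t) :=
  ⟨_, by positivity, sqrt_smul_spin_gradientLift m t⟩

theorem continuousOn_lineGradient {α : Type*} [TopologicalSpace α] {f g : α → ℂ} {s : Set α}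
    (hf : ContinuousOn f s) (hg : ContinuousOn g s) (hf1 : ∀ x ∈ s, ‖f x‖ < 1)
    (hg1 : ∀ x ∈ s, ‖g x‖ = 1) : ContinuousOn (fun x => lineGradient (f x) (g x)) s :=
  ((continuousOn_const.mul hg).inner (hf.sub hg)).div (hg.inner (hf.sub hg))
    fun x hx => (inner_sub_neg (hf1 x hx) (hg1 x hx)).ne

theorem conj_mul_sub_eq {X v : ℂ} (hX : ‖X‖ < 1) (hv : ‖v‖ = 1) :
    conj v * (X - v) = inner ℝ v (X - v) • (1 + lineGradient X v * I) := by
  have hm : lineGradient X v * inner ℝ v (X - v) = inner ℝ (I * v) (X - v) :=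
    div_mul_cancel₀ _ (inner_sub_neg hX hv).ne
  apply Complex.ext
  · simp [Complex.inner, mul_comm]
  · rw [smul_im, smul_eq_mul, mul_comm (inner ℝ v (X - v))]
    simp only [add_im, one_im, zero_add, im_ofReal_mul, I_im, mul_one]
    rw [hm]
    simp [Complex.inner]
    ring

/-- The lift to `ℝ` of the involution of the circle exchanging the ends of the chords
through `X`. -/
def chordLift (X : ℂ) (t : ℝ) : ℝ :=
  gradientLift (lineGradient X (Circle.exp (2 * Real.pi * t))) t

theorem lt_chordLift (X : ℂ) (t : ℝ) : t < chordLift X t := lt_gradientLift _ _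

theorem chordLift_lt_add_one (X : ℂ) (t : ℝ) : chordLift X t < t + 1 := gradientLift_lt_add_one _ _

theorem chordLift_add_one (X : ℂ) (t : ℝ) : chordLift X (t + 1) = chordLift X t + 1 := by
  rw [chordLift, exp_two_pi_mul_add_one, gradientLift_add_one, chordLift]

section ChordLift

variable {X z : ℂ} {s t : ℝ} (hX : ‖X‖ < 1)
include hX

theorem hasDirection_chordLift : HasDirection (spinMap X (spin t)) (chordLift X t) := by
  have hd := inner_sub_neg hX (norm_spin_sq t)
  have h := conj_mul_sub_eq hX (norm_spin_sq t)
  rw [← coe_exp_two_pi_mul] at hd h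
  have hz := spin_mul_conj t
  have key : spinMap X (spin t) = -inner ℝ (Circle.exp (2 * Real.pi * t) : ℂ)
      (X - Circle.exp (2 * Real.pi * t)) •
        (I * spin t * (1 + lineGradient X (Circle.exp (2 * Real.pi * t)) * I)) := by
    rw [mul_comm (I * spin t), ← smul_mul_assoc, neg_smul, ← h, coe_exp_two_pi_mul, map_pow,
      spinMap_apply]
    linear_combination (I * X * conj (spin t) - I * spin t * (spin t * conj (spin t) + 1)) * hz
  rw [key]
  exact (hasDirection_gradientLift _ t).smul (neg_pos.2 hd)

theorem HasDirection.spinMap (hz : HasDirection z t) :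
    HasDirection (spinMap X z) (chordLift X t) := by
  obtain ⟨r, hr, rfl⟩ := hz
  rw [map_smul]
  exact (hasDirection_chordLift hX).smul hr

theorem chordLift_chordLift (t : ℝ) : chordLift X (chordLift X t) = t + 1 := by
  have h : HasDirection (BarBilliard.spinMap X (BarBilliard.spinMap X (spin t)))
      (chordLift X (chordLift X t)) := ((hasDirection_spin t).spinMap hX).spinMap hX
  rw [spinMap_spinMap] at h
  have h' := ((hasDirection_spin t).smul (lorentz_self_pos.2 hX)).neg
  have := lt_chordLift X t
  have := chordLift_lt_add_one X t
  have := lt_chordLift X (chordLift X t)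
  have := chordLift_lt_add_one X (chordLift X t)
  exact h.eq_of_cross_eq_zero h' (by linarith) (by linarith) (cross_self _)

theorem continuous_chordLift : Continuous (chordLift X) := by
  have hg : Continuous fun t : ℝ => lineGradient X (Circle.exp (2 * Real.pi * t)) :=
    continuousOn_univ.1 <| continuousOn_lineGradient (by fun_prop) (by fun_prop)
      (fun _ _ => hX) fun _ _ => Circle.norm_coe _
  exact continuous_gradientLift.comp (hg.prodMk continuous_id)

theorem strictMono_chordLift : StrictMono (chordLift X) := by
  have hinj : Function.Injective (chordLift X) := fun s t h => by
    have hs := chordLift_chordLift hX s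
    rw [h, chordLift_chordLift hX t] at hs
    linarith
  refine ((continuous_chordLift hX).strictMono_of_inj hinj).resolve_right fun h => ?_
  have := h (show (0 : ℝ) < 0 + 1 by norm_num)
  rw [chordLift_add_one] at this
  linarith

end ChordLift

/-! ### The lift of the bar-billiard map -/

theorem lowerBounds_lineGradient_convexHull {s : Set ℂ} (hs : s ⊆ Metric.ball 0 1) {v : ℂ}
    (hv : ‖v‖ = 1) :
    lowerBounds ((fun u => lineGradient u v) '' convexHull ℝ s) =
      lowerBounds ((fun u => lineGradient u v) '' s) := by
  refine (lowerBounds_mono_set (Set.image_mono (subset_convexHull ℝ s))).antisymm ?_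
  rintro m hm _ ⟨u, hu, rfl⟩
  have hball : convexHull ℝ s ⊆ Metric.ball 0 1 := convexHull_min hs (convex_ball _ _)
  have hle : ∀ w ∈ Metric.ball (0 : ℂ) 1, m ≤ lineGradient w v ↔
      innerSL ℝ (I * v - m • v) w ≤ inner ℝ (I * v - m • v) v := by
    intro w hw
    rw [lineGradient, le_div_iff_of_neg (inner_sub_neg (mem_ball_zero_iff.1 hw) hv),
      innerSL_apply_apply, ← sub_nonpos (b := inner ℝ _ v), ← inner_sub_right, inner_sub_left,
      real_inner_smul_left, sub_nonpos]
  refine (hle u (hball hu)).2 (convexHull_min (fun w hw => ?_)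
    (convex_halfSpace_le (innerSL ℝ (I * v - m • v)).isLinear _) hu)
  exact (hle w (hs hw)).1 (hm (Set.mem_image_of_mem _ hw))

section TangentLift

variable {U : Set ℂ} (hc : IsCompact U) (hU : U ⊆ Metric.ball 0 1)
include hc hU

theorem isLeast_minGradient (hne : U.Nonempty) {v : ℂ} (hv : ‖v‖ = 1) :
    IsLeast ((fun u => lineGradient u v) '' U) (minGradient U v) := by
  have hcont : ContinuousOn (fun u => lineGradient u v) U :=
    continuousOn_lineGradient (by fun_prop) (by fun_prop) (fun u hu => mem_ball_zero_iff.1 (hU hu))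
      fun _ _ => hv
  obtain ⟨m, hm⟩ := (hc.image_of_continuousOn hcont).exists_isLeast (hne.image _)
  rwa [minGradient, hm.csInf_eq]

theorem minGradient_convexHull (hne : U.Nonempty) {v : ℂ} (hv : ‖v‖ = 1) :
    minGradient (convexHull ℝ U) v = minGradient U v := by
  have h : IsGLB ((fun u => lineGradient u v) '' convexHull ℝ U) (minGradient U v) := by
    rw [IsGLB, lowerBounds_lineGradient_convexHull hU hv]
    exact (isLeast_minGradient hc hU hne hv).isGLB
  exact h.csInf_eq (hne.convexHull.image _)

theorem psi_convexHull (hne : U.Nonempty) : psi (convexHull ℝ U) = psi U := by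
  funext v
  apply Circle.ext
  simp only [psi, minGradient_convexHull hc hU hne (Circle.norm_coe v)]

theorem continuous_minGradient : Continuous fun v : Circle => minGradient U v := by
  have : CompactSpace U := isCompact_iff_compactSpace.1 hc
  have h : Continuous fun p : Circle × U => lineGradient p.2 p.1 :=
    continuousOn_univ.1 <| continuousOn_lineGradient (by fun_prop) (by fun_prop)
      (fun p _ => mem_ball_zero_iff.1 (hU p.2.2)) fun _ _ => Circle.norm_coe _
  convert isCompact_univ.continuous_sInf (f := fun (v : Circle) (u : U) => lineGradient u v) h
    using 2 with v
  rw [minGradient, Set.image_univ, Set.image_eq_range]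

end TangentLift

/-- The lift to `ℝ` of the bar-billiard map of `U`. -/
def tangentLift (U : Set ℂ) (t : ℝ) : ℝ :=
  gradientLift (minGradient U (Circle.exp (2 * Real.pi * t))) t

theorem tangentLift_add_one (U : Set ℂ) (t : ℝ) :
    tangentLift U (t + 1) = tangentLift U t + 1 := by
  rw [tangentLift, exp_two_pi_mul_add_one, gradientLift_add_one, tangentLift]

section TangentLift

variable {U : Set ℂ} (hc : IsCompact U) (hU : U ⊆ Metric.ball 0 1)
include hc hU

theorem isLeast_tangentLift (hne : U.Nonempty) (t : ℝ) :
    IsLeast ((chordLift · t) '' U) (tangentLift U t) := by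
  have h := (monotone_gradientLift t).map_isLeast
    (isLeast_minGradient hc hU hne (Circle.norm_coe (Circle.exp (2 * Real.pi * t))))
  rwa [Set.image_image] at h

theorem continuous_tangentLift : Continuous (tangentLift U) :=
  continuous_gradientLift.comp
    (((continuous_minGradient hc hU).comp (by fun_prop)).prodMk continuous_id)

theorem strictMono_tangentLift (hne : U.Nonempty) : StrictMono (tangentLift U) := by
  intro s t hst
  obtain ⟨X, hX, ht⟩ := (isLeast_tangentLift hc hU hne t).1
  calc tangentLift U s ≤ chordLift X s :=
        (isLeast_tangentLift hc hU hne s).2 (Set.mem_image_of_mem _ hX)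
    _ < chordLift X t := strictMono_chordLift (mem_ball_zero_iff.1 (hU hX)) hst
    _ = tangentLift U t := ht

end TangentLift

theorem coe_psi (U : Set ℂ) (v : Circle) :
    (1 + minGradient U v ^ 2) • (psi U v : ℂ) = -v * (1 + minGradient U v * I) ^ 2 := by
  set m := minGradient U v
  have hm : (1 : ℝ) + m ^ 2 ≠ 0 := by positivity
  have hdir : (v : ℂ) + m * (I * v) = v * (1 + m * I) := by ring
  have hinner : inner ℝ ((v : ℂ) * (1 + m * I)) (v : ℂ) = (1 : ℝ) := by
    rw [real_inner_comm, Complex.inner, mul_right_comm, mul_conj, normSq_eq_norm_sq,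
      Circle.norm_coe]
    simp
  have hnorm : inner ℝ ((v : ℂ) * (1 + m * I)) (v * (1 + m * I)) = 1 + m ^ 2 := by
    rw [real_inner_self_eq_norm_sq, norm_mul, Circle.norm_coe, one_mul, ← normSq_eq_norm_sq,
      normSq_apply]
    simp [pow_two]
  have h : (psi U v : ℂ) = (-2 * inner ℝ ((v : ℂ) + m * (I * v)) ((v : ℂ) - 0) /
      inner ℝ ((v : ℂ) + m * (I * v)) (v + m * (I * v))) • ((v : ℂ) + m * (I * v)) + v := rfl
  rw [h, sub_zero, hdir, hinner, hnorm, smul_add, smul_smul, mul_div_cancel₀ _ hm]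
  simp only [real_smul]
  push_cast
  linear_combination (v : ℂ) * (m : ℂ) ^ 2 * I_sq

theorem isNormalizedLift_tangentLift {U : Set ℂ} (hc : IsCompact U) (hU : U ⊆ Metric.ball 0 1)
    (hne : U.Nonempty) : IsNormalizedLift (psi U) (tangentLift U) where
  continuous := continuous_tangentLift hc hU
  strictMono := strictMono_tangentLift hc hU hne
  map_add_one := tangentLift_add_one U
  semiconj t := by
    apply Circle.ext
    set m := minGradient U (Circle.exp (2 * Real.pi * t)) with hm
    have hm0 : 0 < 1 + m ^ 2 := by positivity
    have h := congrArg (· ^ 2) (sqrt_smul_spin_gradientLift m t)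
    simp only [smul_pow, Real.sq_sqrt hm0.le, mul_pow, I_sq] at h
    rw [← smul_right_inj hm0.ne', coe_psi, ← hm, coe_exp_two_pi_mul, coe_exp_two_pi_mul,
      tangentLift, h, neg_one_mul]
  map_zero_mem := ⟨(lt_gradientLift _ 0).le, (gradientLift_lt_add_one _ 0).trans_eq (zero_add 1)⟩

theorem hasRotationNumber_of_iterate_crossing {f : Circle → Circle} {F : ℝ → ℝ}
    (hF : IsNormalizedLift f F) {n : ℕ} (hn : 0 < n) {k : ℤ} (hlo : ∃ x, x + k ≤ F^[n] x)
    (hhi : ∃ x, F^[n] x ≤ x + k) : HasRotationNumber f (k / n) := by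
  refine ⟨F, hF, fun x => ?_⟩
  let g : CircleDeg1Lift := ⟨⟨F, hF.strictMono.monotone⟩, hF.map_add_one⟩
  have hg : ∀ j : ℕ, ⇑(g ^ j) = F^[j] := CircleDeg1Lift.coe_pow g
  obtain ⟨y, hy⟩ := hlo
  obtain ⟨z, hz⟩ := hhi
  obtain ⟨w, hw⟩ := mem_range_of_exists_le_of_exists_ge
    ((hF.continuous.iterate n).sub continuous_id)
    ⟨z, sub_le_iff_le_add'.2 hz⟩ ⟨y, le_sub_iff_add_le'.2 hy⟩
  have hgw : (g ^ n) w = w + k := by rw [hg]; exact sub_eq_iff_eq_add'.1 hw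
  simpa only [hg, g.translationNumber_of_map_pow_eq_add_int hgw hn] using
    g.tendsto_translationNumber x

/-! ### Points dividing a chord -/

theorem lorentz_spin_sq (a b : ℝ) :
    lorentz (spin a ^ 2) (spin b ^ 2) = 2 * cross (spin a) (spin b) ^ 2 := by
  have ha := spin_re_sq_add_im_sq a
  have hb := spin_re_sq_add_im_sq b
  simp only [lorentz_eq, cross, pow_two, mul_re, mul_im]
  linear_combination -((spin b).re ^ 2 + (spin b).im ^ 2) * ha - hb

theorem spin_sq_sub_spin_sq (a b : ℝ) : spin b ^ 2 - spin a ^ 2 =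
    (2 * cross (spin a) (spin b)) • (I * (spin a * spin b)) := by
  have hcross : ((2 * cross (spin a) (spin b) : ℝ) : ℂ) * I =
      conj (spin a) * spin b - spin a * conj (spin b) := by
    apply Complex.ext
    · simp
    · simp [cross]; ring
  rw [real_smul, ← mul_assoc, hcross]
  linear_combination -spin b ^ 2 * spin_mul_conj a + spin a ^ 2 * spin_mul_conj b

theorem spinMap_spin_sq (a : ℝ) (z : ℂ) :
    spinMap (spin a ^ 2) z = -(2 * cross (spin a) z) • spin a := by
  have ha := spin_re_sq_add_im_sq a
  apply Complex.ext <;> simp [spinMap_re, spinMap_im, pow_two, cross]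
  · linear_combination z.im * ha
  · linear_combination -z.re * ha

/-- The point dividing the chord from `exp (2πia)` to `exp (2πib)` in the ratio `x : 1 - x`. -/
def chordPoint (a b x : ℝ) : ℂ := AffineMap.lineMap (spin a ^ 2) (spin b ^ 2) x

section ChordPoint

variable (a b x y : ℝ)

theorem chordPoint_eq : chordPoint a b x = (1 - x) • spin a ^ 2 + x • spin b ^ 2 :=
  AffineMap.lineMap_apply_module _ _ _

theorem lorentz_chordPoint (X : ℂ) : lorentz X (chordPoint a b x) =
    (1 - x) * lorentz X (spin a ^ 2) + x * lorentz X (spin b ^ 2) := by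
  simp only [lorentz, chordPoint_eq, inner_add_right, real_inner_smul_right]
  ring

theorem lorentz_chordPoint_chordPoint : lorentz (chordPoint a b x) (chordPoint a b y) =
    2 * cross (spin a) (spin b) ^ 2 * (x * (1 - y) + y * (1 - x)) := by
  rw [lorentz_chordPoint, lorentz_comm _ (spin a ^ 2), lorentz_comm _ (spin b ^ 2),
    lorentz_chordPoint, lorentz_chordPoint]
  simp only [lorentz_spin_sq, cross_self, cross_anticomm (spin b) (spin a)]
  ring

theorem one_sub_norm_chordPoint_sq :
    1 - ‖chordPoint a b x‖ ^ 2 = 4 * cross (spin a) (spin b) ^ 2 * (x * (1 - x)) := by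
  rw [← lorentz_self, lorentz_chordPoint_chordPoint]
  ring

theorem spinMap_chordPoint (z : ℂ) : spinMap (chordPoint a b x) z =
    -(2 * (1 - x) * cross (spin a) z) • spin a + -(2 * x * cross (spin b) z) • spin b := by
  have h : spinMap (chordPoint a b x) z =
      (1 - x) • spinMap (spin a ^ 2) z + x • spinMap (spin b ^ 2) z := by
    simp only [chordPoint_eq, spinMap_apply, real_smul]
    push_cast
    ring
  rw [h, spinMap_spin_sq, spinMap_spin_sq, smul_smul, smul_smul]
  ring_nf

theorem cross_spinMap_chordPoint (z w : ℂ) :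
    cross (spinMap (chordPoint a b y) z) (spinMap (chordPoint a b x) w) =
      4 * cross (spin a) (spin b) * (x * (1 - y) * (cross (spin a) z * cross (spin b) w) -
        y * (1 - x) * (cross (spin b) z * cross (spin a) w)) := by
  rw [spinMap_chordPoint, spinMap_chordPoint, cross_smul_add_smul]
  ring

theorem chordPoint_reverse : chordPoint b (a + 1) (1 - x) = chordPoint a b x := by
  rw [chordPoint, spin_add_one, neg_sq, AffineMap.lineMap_apply_one_sub, chordPoint]

end ChordPoint

/-- `P` and `Q` lie in the open disk on the chord from `exp (2πia)` to `exp (2πib)`, dividing it in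
the ratios `p : 1 - p` and `q : 1 - q`, with `P` first. -/
structure ChordFrame (P Q : ℂ) (a b p q : ℝ) : Prop where
  lt : a < b
  lt_add_one : b < a + 1
  pos : 0 < p
  param_lt : p < q
  lt_one : q < 1
  left_eq : P = chordPoint a b p
  right_eq : Q = chordPoint a b q

theorem exists_spin_sq_eq {z : ℂ} (hz : ‖z‖ = 1) : ∃ t, spin t ^ 2 = z := by
  refine ⟨z.arg / (2 * Real.pi), ?_⟩
  rw [← coe_exp_two_pi_mul, mul_div_cancel₀ _ Real.two_pi_pos.ne']
  exact congrArg Subtype.val (Circle.exp_arg ⟨z, mem_sphere_zero_iff_norm.2 hz⟩)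

theorem spin_add_int_sq (t : ℝ) (n : ℤ) : spin (t + n) ^ 2 = spin t ^ 2 := by
  rw [← coe_exp_two_pi_mul, ← coe_exp_two_pi_mul, mul_add, Circle.exp_add,
    mul_comm (2 * Real.pi) (n : ℝ), Circle.exp_int_mul_two_pi, mul_one]

theorem exists_mem_Ioo_spin_sq_eq {z : ℂ} (hz : ‖z‖ = 1) {a : ℝ} (ha : spin a ^ 2 ≠ z) :
    ∃ t ∈ Set.Ioo a (a + 1), spin t ^ 2 = z := by
  obtain ⟨t, rfl⟩ := exists_spin_sq_eq hz
  have ht : spin (t + -⌊t - a⌋) ^ 2 = spin t ^ 2 := by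
    exact_mod_cast spin_add_int_sq t (-⌊t - a⌋)
  refine ⟨t + -⌊t - a⌋, ⟨lt_of_le_of_ne ?_ ?_, ?_⟩, ht⟩
  · linarith [Int.floor_le (t - a)]
  · intro h
    exact ha (h ▸ ht)
  · linarith [Int.lt_floor_add_one (t - a)]

theorem exists_chordFrame {P Q : ℂ} (hP : ‖P‖ < 1) (hQ : ‖Q‖ < 1) (hPQ : P ≠ Q) :
    ∃ a b p q, ChordFrame P Q a b p q := by
  set s := exitParam P Q
  set s' := exitParam Q P
  have hs1 : 1 < s := one_lt_exitParam hQ hPQ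
  have hs1' : 1 < s' := one_lt_exitParam hP hPQ.symm
  have hB : exitPoint P Q = P + s * (Q - P) := rfl
  have hA : exitPoint Q P = Q + s' * (P - Q) := rfl
  have hr : 0 < s + s' - 1 := by linarith
  have hrC : ((s : ℂ) + s' - 1) ≠ 0 := by exact_mod_cast hr.ne'
  have hne : exitPoint Q P ≠ exitPoint P Q := by
    intro h
    have : ((s : ℂ) + s' - 1) * (Q - P) = 0 := by linear_combination hA - hB - h
    exact hPQ (sub_eq_zero.1 ((mul_eq_zero.1 this).resolve_left hrC)).symm
  obtain ⟨a, ha⟩ := exists_spin_sq_eq (norm_exitPoint hQ hPQ.symm)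
  obtain ⟨b, hab, hb⟩ := exists_mem_Ioo_spin_sq_eq (norm_exitPoint hP hPQ) (ha ▸ hne)
  refine ⟨a, b, (s' - 1) / (s + s' - 1), s' / (s + s' - 1), hab.1, hab.2, ?_, ?_, ?_, ?_, ?_⟩
  · exact div_pos (by linarith) hr
  · exact (div_lt_div_iff_of_pos_right hr).2 (by linarith)
  · rw [div_lt_one hr]; linarith
  all_goals
    rw [chordPoint_eq, ha, hb, hA, hB]
    simp only [real_smul]
    push_cast
    field_simp
    ring

namespace ChordFrame

variable {P Q : ℂ} {a b p q : ℝ} (h : ChordFrame P Q a b p q)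
include h

theorem reverse : ChordFrame Q P b (a + 1) (1 - q) (1 - p) where
  lt := h.lt_add_one
  lt_add_one := by linarith [h.lt]
  pos := by linarith [h.lt_one]
  param_lt := by linarith [h.param_lt]
  lt_one := by linarith [h.pos]
  left_eq := by rw [chordPoint_reverse, h.right_eq]
  right_eq := by rw [chordPoint_reverse, h.left_eq]

theorem cross_pos : 0 < cross (spin a) (spin b) := cross_spin_spin_pos h.lt h.lt_add_one

theorem norm_chordPoint_lt_one_iff {x : ℝ} : ‖chordPoint a b x‖ < 1 ↔ x ∈ Set.Ioo 0 1 := by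
  have hσ : 0 < 4 * cross (spin a) (spin b) ^ 2 := by have := h.cross_pos; positivity
  rw [← sq_lt_one_iff₀ (norm_nonneg _), ← sub_pos, one_sub_norm_chordPoint_sq,
    mul_pos_iff_of_pos_left hσ, mul_pos_iff, sub_pos, sub_neg, Set.mem_Ioo]
  exact or_iff_left fun h => by linarith

theorem norm_left_lt_one : ‖P‖ < 1 := by
  rw [h.left_eq, h.norm_chordPoint_lt_one_iff]
  exact ⟨h.pos, h.param_lt.trans h.lt_one⟩

theorem norm_right_lt_one : ‖Q‖ < 1 := h.reverse.norm_left_lt_one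

theorem sub_eq : Q - P = (q - p) • (spin b ^ 2 - spin a ^ 2) := by
  rw [h.left_eq, h.right_eq, chordPoint_eq, chordPoint_eq]
  module

theorem spin_sq_sub_ne_zero : spin b ^ 2 - spin a ^ 2 ≠ 0 := by
  rw [spin_sq_sub_spin_sq]
  have := h.cross_pos
  exact smul_ne_zero (by positivity)
    (mul_ne_zero I_ne_zero (mul_ne_zero (spin_ne_zero a) (spin_ne_zero b)))

theorem ne : P ≠ Q := by
  rw [ne_comm, ← sub_ne_zero, h.sub_eq]
  exact smul_ne_zero (sub_ne_zero.2 h.param_lt.ne') h.spin_sq_sub_ne_zero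

theorem exitPoint_eq : exitPoint P Q = spin b ^ 2 := by
  set x := p + exitParam P Q * (q - p) with hx
  have hexit : exitPoint P Q = chordPoint a b x := by
    rw [exitPoint, h.sub_eq, ← real_smul, chordPoint_eq, hx]
    nth_rw 1 [h.left_eq, chordPoint_eq]
    module
  have hx0 : 0 < x := by
    have := h.pos
    have := sub_pos.2 h.param_lt
    have := zero_lt_one.trans (one_lt_exitParam h.norm_right_lt_one h.ne)
    positivity
  have hnorm := one_sub_norm_chordPoint_sq a b x
  rw [← hexit, norm_exitPoint h.norm_left_lt_one h.ne, one_pow, sub_self, eq_comm, mul_eq_zero,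
    or_iff_right (by have := h.cross_pos; positivity), mul_eq_zero, or_iff_right hx0.ne',
    sub_eq_zero] at hnorm
  rw [hexit, ← hnorm, chordPoint, AffineMap.lineMap_apply_one]

theorem exp_two_mul_kleinDist :
    Real.exp (2 * kleinDist P Q) = q * (1 - p) / (p * (1 - q)) := by
  have hp := h.pos
  have hq := hp.trans h.param_lt
  have hq1 := sub_pos.2 h.lt_one
  have hp1 := sub_pos.2 (h.param_lt.trans h.lt_one)
  have hd : 0 < dist (spin a ^ 2) (spin b ^ 2) := by
    rw [dist_comm, dist_eq_norm]
    exact norm_pos_iff.2 h.spin_sq_sub_ne_zero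
  have hA : exitPoint Q P = spin a ^ 2 := by
    rw [h.reverse.exitPoint_eq, spin_add_one, neg_sq]
  have hratio : 1 ≤ q * (1 - p) / (p * (1 - q)) := by
    rw [one_le_div (mul_pos hp hq1)]
    linarith [h.param_lt]
  rw [kleinDist, if_neg h.ne, h.exitPoint_eq, hA, h.left_eq, h.right_eq, chordPoint, chordPoint,
    dist_left_lineMap, dist_left_lineMap, dist_right_lineMap, dist_right_lineMap,
    Real.norm_of_nonneg hp.le, Real.norm_of_nonneg hq.le, Real.norm_of_nonneg hp1.le,
    Real.norm_of_nonneg hq1.le, mul_mul_mul_comm, mul_mul_mul_comm p,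
    mul_div_mul_right _ _ (mul_pos hd hd).ne', abs_of_nonneg (Real.log_nonneg hratio), ← mul_assoc,
    mul_one_div_cancel two_ne_zero, one_mul, Real.exp_log (zero_lt_one.trans_le hratio)]

end ChordFrame

/-! ### Hyperbolic distances -/

/-- Twice the signed area of the triangle `PQR`, positive when it is oriented counterclockwise. -/
def twiceArea (P Q R : ℂ) : ℝ := cross (Q - P) (R - P)

theorem twiceArea_rotate (P Q R : ℂ) : twiceArea Q R P = twiceArea P Q R := by
  simp only [twiceArea, cross, sub_re, sub_im]; ring

theorem twiceArea_swap (P Q R : ℂ) : twiceArea Q P R = -twiceArea P Q R := by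
  simp only [twiceArea, cross, sub_re, sub_im]; ring

theorem twiceArea_ne_zero {P Q R : ℂ} (h : AffineIndependent ℝ ![P, Q, R]) :
    twiceArea P Q R ≠ 0 := by
  intro harea
  have hPQ : P ≠ Q := h.injective.ne (show (0 : Fin 3) ≠ 1 by decide)
  obtain ⟨r, hr⟩ := exists_smul_eq_of_cross_eq_zero (sub_ne_zero.2 hPQ.symm) harea
  refine affineIndependent_iff_not_collinear_set.1 h
    ((collinear_iff_of_mem (Set.mem_insert P _)).2 ⟨Q - P, ?_⟩)
  rintro X (rfl | rfl | rfl)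
  exacts [⟨0, by simp⟩, ⟨1, by simp⟩, ⟨r, by simp [← hr]⟩]

theorem kleinDist_self (P : ℂ) : kleinDist P P = 0 := if_pos rfl

theorem kleinDist_comm (P Q : ℂ) : kleinDist P Q = kleinDist Q P := by
  simp only [kleinDist, eq_comm, mul_comm]

theorem kleinDist_nonneg (P Q : ℂ) : 0 ≤ kleinDist P Q := by
  unfold kleinDist
  split_ifs <;> positivity

theorem lineDist_comm (P Q R : ℂ) : lineDist P Q R = lineDist Q P R := by
  rw [lineDist, Set.pair_comm, lineDist]

theorem lineDist_nonneg (P Q R : ℂ) : 0 ≤ lineDist P Q R :=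
  Real.sInf_nonneg (by rintro _ ⟨S, -, -, rfl⟩; exact kleinDist_nonneg R S)

theorem lineDist_le_kleinDist {P Q R S : ℂ} (hS : S ∈ line[ℝ, P, Q]) (hS1 : ‖S‖ < 1) :
    lineDist P Q R ≤ kleinDist R S :=
  csInf_le ⟨0, by rintro _ ⟨S, -, -, rfl⟩; exact kleinDist_nonneg R S⟩ ⟨S, hS, hS1, rfl⟩

namespace ChordFrame

variable {P Q R : ℂ} {a b p q : ℝ} (h : ChordFrame P Q a b p q)
include h

theorem kleinDist_pos : 0 < kleinDist P Q := by
  have hp := h.pos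
  have hq1 := sub_pos.2 h.lt_one
  have hexp : 1 < Real.exp (2 * kleinDist P Q) := by
    rw [h.exp_two_mul_kleinDist, one_lt_div (mul_pos hp hq1)]
    linarith [h.param_lt]
  linarith [Real.one_lt_exp_iff.1 hexp]

theorem cosh_kleinDist_sq :
    Real.cosh (kleinDist P Q) ^ 2 * (lorentz P P * lorentz Q Q) = lorentz P Q ^ 2 := by
  have hp := h.pos
  have hq := hp.trans h.param_lt
  have hq1 := sub_pos.2 h.lt_one
  have hp1 := sub_pos.2 (h.param_lt.trans h.lt_one)
  have hcosh : Real.cosh (kleinDist P Q) ^ 2 =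
      (Real.exp (2 * kleinDist P Q) + 2 + (Real.exp (2 * kleinDist P Q))⁻¹) / 4 := by
    rw [Real.cosh_eq, two_mul, Real.exp_add, Real.exp_neg]
    field_simp
    ring
  rw [hcosh, h.exp_two_mul_kleinDist, h.left_eq, h.right_eq, lorentz_chordPoint_chordPoint,
    lorentz_chordPoint_chordPoint, lorentz_chordPoint_chordPoint]
  field_simp
  ring

theorem mem_line_iff {S : ℂ} : S ∈ line[ℝ, P, Q] ↔ ∃ x, chordPoint a b x = S := by
  have hline (r : ℝ) : AffineMap.lineMap P Q r = chordPoint a b (AffineMap.lineMap p q r) := by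
    rw [h.left_eq, h.right_eq]
    exact (AffineMap.apply_lineMap (AffineMap.lineMap (spin a ^ 2) (spin b ^ 2)) p q r).symm
  simp only [mem_affineSpan_pair_iff_exists_lineMap_eq, hline]
  refine ⟨fun ⟨r, hr⟩ => ⟨_, hr⟩, fun ⟨x, hx⟩ => ⟨(x - p) / (q - p), ?_⟩⟩
  rw [← hx, AffineMap.lineMap_apply_ring', div_mul_cancel₀ _ (sub_ne_zero.2 h.param_lt.ne'),
    sub_add_cancel]

theorem twiceArea_eq : twiceArea P Q R =
    2 * cross (spin a) (spin b) * (q - p) * cross (spin b) (spinMap R (spin a)) := by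
  have hP : cross (spin b) (spinMap P (spin a)) = 0 := by
    rw [h.left_eq, spinMap_chordPoint, cross_self, mul_zero, neg_zero, zero_smul, zero_add,
      cross_smul_right, cross_self, mul_zero]
  have hR : cross (spin b) (spinMap R (spin a)) = cross (I * (spin a * spin b)) (R - P) := by
    rw [← sub_zero (cross _ _), ← hP]
    simp only [cross, spinMap_re, spinMap_im, sub_re, sub_im, mul_re, mul_im, I_re, I_im]
    ring
  rw [hR, twiceArea, h.sub_eq, spin_sq_sub_spin_sq, smul_smul, cross_smul_left]
  ring

end ChordFrame

theorem cosh_kleinDist_sq {X Y : ℂ} (hX : ‖X‖ < 1) (hY : ‖Y‖ < 1) :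
    Real.cosh (kleinDist X Y) ^ 2 * (lorentz X X * lorentz Y Y) = lorentz X Y ^ 2 := by
  rcases eq_or_ne X Y with rfl | hXY
  · rw [kleinDist_self, Real.cosh_zero, one_pow, one_mul, pow_two]
  · obtain ⟨a, b, p, q, h⟩ := exists_chordFrame hX hY hXY
    exact h.cosh_kleinDist_sq

theorem sinh_kleinDist_sq {X Y : ℂ} (hX : ‖X‖ < 1) (hY : ‖Y‖ < 1) :
    Real.sinh (kleinDist X Y) ^ 2 * (lorentz X X * lorentz Y Y) =
      lorentz X Y ^ 2 - lorentz X X * lorentz Y Y := by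
  rw [Real.sinh_sq, sub_mul, cosh_kleinDist_sq hX hY, one_mul]

/-- The parameter of the foot of the perpendicular from `R` to the chord from `exp (2πia)` to
`exp (2πib)`, where the AM-GM inequality bounding the distance from `R` becomes an equality. -/
def footParam (R : ℂ) (a b : ℝ) : ℝ :=
  lorentz R (spin a ^ 2) / (lorentz R (spin a ^ 2) + lorentz R (spin b ^ 2))

theorem footParam_mem_Ioo {R : ℂ} (hR : ‖R‖ < 1) (a b : ℝ) : footParam R a b ∈ Set.Ioo 0 1 := by
  have hA := lorentz_pos hR (norm_spin_sq a).le
  have hB := lorentz_pos hR (norm_spin_sq b).le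
  exact ⟨div_pos hA (by positivity), (div_lt_one (by positivity)).2 (by linarith)⟩

theorem one_sub_footParam_mul {R : ℂ} (hR : ‖R‖ < 1) (a b : ℝ) :
    (1 - footParam R a b) * lorentz R (spin a ^ 2) = footParam R a b * lorentz R (spin b ^ 2) := by
  have hA := lorentz_pos hR (norm_spin_sq a).le
  have hB := lorentz_pos hR (norm_spin_sq b).le
  unfold footParam
  field_simp
  ring

namespace ChordFrame

variable {P Q R : ℂ} {a b p q : ℝ} (h : ChordFrame P Q a b p q) (hR : ‖R‖ < 1)
include h hR

theorem cosh_kleinDist_chordPoint_sq {x : ℝ} (hx : x ∈ Set.Ioo (0 : ℝ) 1) :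
    Real.cosh (kleinDist R (chordPoint a b x)) ^ 2 *
      (cross (spin a) (spin b) ^ 2 * lorentz R R) * (4 * (x * (1 - x))) =
        ((1 - x) * lorentz R (spin a ^ 2) + x * lorentz R (spin b ^ 2)) ^ 2 := by
  rw [← lorentz_chordPoint,
    ← BarBilliard.cosh_kleinDist_sq hR (h.norm_chordPoint_lt_one_iff.2 hx),
    lorentz_chordPoint_chordPoint]
  ring

theorem cosh_kleinDist_footParam_sq :
    Real.cosh (kleinDist R (chordPoint a b (footParam R a b))) ^ 2 *
      (cross (spin a) (spin b) ^ 2 * lorentz R R) =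
        lorentz R (spin a ^ 2) * lorentz R (spin b ^ 2) := by
  have hx := footParam_mem_Ioo hR a b
  have hx' : 4 * (footParam R a b * (1 - footParam R a b)) ≠ 0 :=
    (mul_pos four_pos (mul_pos hx.1 (sub_pos.2 hx.2))).ne'
  have hAB := one_sub_footParam_mul hR a b
  refine mul_right_cancel₀ hx' ((h.cosh_kleinDist_chordPoint_sq hR hx).trans ?_)
  linear_combination ((1 - footParam R a b) * lorentz R (spin a ^ 2) -
    footParam R a b * lorentz R (spin b ^ 2)) * hAB

theorem kleinDist_chordPoint_footParam_le {x : ℝ} (hx : x ∈ Set.Ioo (0 : ℝ) 1) :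
    kleinDist R (chordPoint a b (footParam R a b)) ≤ kleinDist R (chordPoint a b x) := by
  have hG : 0 < cross (spin a) (spin b) ^ 2 * lorentz R R :=
    mul_pos (pow_pos h.cross_pos 2) (lorentz_pos hR hR.le)
  have hx' : 0 < 4 * (x * (1 - x)) :=
    mul_pos four_pos (mul_pos hx.1 (sub_pos.2 hx.2))
  have hamgm : lorentz R (spin a ^ 2) * lorentz R (spin b ^ 2) * (4 * (x * (1 - x))) ≤
      ((1 - x) * lorentz R (spin a ^ 2) + x * lorentz R (spin b ^ 2)) ^ 2 := by
    linarith [sq_nonneg ((1 - x) * lorentz R (spin a ^ 2) - x * lorentz R (spin b ^ 2))]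
  rwa [← h.cosh_kleinDist_chordPoint_sq hR hx, ← h.cosh_kleinDist_footParam_sq hR,
    mul_le_mul_iff_left₀ hx', mul_le_mul_iff_left₀ hG, sq_le_sq, abs_of_pos (Real.cosh_pos _),
    abs_of_pos (Real.cosh_pos _), Real.cosh_le_cosh, abs_of_nonneg (kleinDist_nonneg _ _),
    abs_of_nonneg (kleinDist_nonneg _ _)] at hamgm

theorem lineDist_eq : lineDist P Q R = kleinDist R (chordPoint a b (footParam R a b)) := by
  refine IsLeast.csInf_eq ⟨⟨_, h.mem_line_iff.2 ⟨_, rfl⟩,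
    h.norm_chordPoint_lt_one_iff.2 (footParam_mem_Ioo hR a b), rfl⟩, ?_⟩
  rintro _ ⟨S, hS, hS1, rfl⟩
  obtain ⟨x, rfl⟩ := h.mem_line_iff.1 hS
  exact h.kleinDist_chordPoint_footParam_le hR (h.norm_chordPoint_lt_one_iff.1 hS1)

theorem cosh_lineDist_sq :
    Real.cosh (lineDist P Q R) ^ 2 * (cross (spin a) (spin b) ^ 2 * lorentz R R) =
      lorentz R (spin a ^ 2) * lorentz R (spin b ^ 2) := by
  rw [h.lineDist_eq hR, h.cosh_kleinDist_footParam_sq hR]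

theorem sinh_lineDist_sq :
    Real.sinh (lineDist P Q R) ^ 2 * (cross (spin a) (spin b) ^ 2 * lorentz R R) =
      cross (spin b) (spinMap R (spin a)) ^ 2 := by
  rw [Real.sinh_sq, sub_mul, h.cosh_lineDist_sq hR, ← cross_spin_spinMap_spin,
    ← cross_spin_spinMap_spin]
  have := cross_mul_cross_sub (spin a) (spin b) (spinMap R (spin a)) (spinMap R (spin b))
  rw [cross_spinMap_spinMap, cross_spinMap_comm R (spin a) (spin b)] at this
  linear_combination this

end ChordFrame

theorem sinh_kleinDist_mul_sinh_lineDist_sq {P Q R : ℂ} (hP : ‖P‖ < 1) (hQ : ‖Q‖ < 1)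
    (hR : ‖R‖ < 1) (hPQ : P ≠ Q) :
    (Real.sinh (kleinDist P Q) * Real.sinh (lineDist P Q R)) ^ 2 *
      (lorentz P P * lorentz Q Q * lorentz R R) = twiceArea P Q R ^ 2 := by
  obtain ⟨a, b, p, q, h⟩ := exists_chordFrame hP hQ hPQ
  have hσ : cross (spin a) (spin b) ^ 2 ≠ 0 := (pow_pos h.cross_pos 2).ne'
  have hPQd := sinh_kleinDist_sq hP hQ
  have hRd := h.sinh_lineDist_sq hR
  have hl : lorentz P Q ^ 2 - lorentz P P * lorentz Q Q =
      4 * cross (spin a) (spin b) ^ 4 * (q - p) ^ 2 := by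
    rw [h.left_eq, h.right_eq]
    simp only [lorentz_chordPoint_chordPoint]
    ring
  rw [h.twiceArea_eq]
  apply mul_right_cancel₀ hσ
  linear_combination Real.sinh (lineDist P Q R) ^ 2 * lorentz R R * cross (spin a) (spin b) ^ 2 *
    (hPQd + hl) + 4 * cross (spin a) (spin b) ^ 4 * (q - p) ^ 2 * hRd

theorem kleinDist_pos {P Q : ℂ} (hP : ‖P‖ < 1) (hQ : ‖Q‖ < 1) (hPQ : P ≠ Q) :
    0 < kleinDist P Q := by
  obtain ⟨a, b, p, q, h⟩ := exists_chordFrame hP hQ hPQ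
  exact h.kleinDist_pos

theorem sinh_kleinDist_mul_sinh_lineDist_rotate {P Q R : ℂ} (hP : ‖P‖ < 1) (hQ : ‖Q‖ < 1)
    (hR : ‖R‖ < 1) (hPQ : P ≠ Q) (hQR : Q ≠ R) :
    Real.sinh (kleinDist Q R) * Real.sinh (lineDist Q R P) =
      Real.sinh (kleinDist P Q) * Real.sinh (lineDist P Q R) := by
  have hlorentz : lorentz P P * lorentz Q Q * lorentz R R ≠ 0 :=
    (mul_pos (mul_pos (lorentz_self_pos.2 hP) (lorentz_self_pos.2 hQ)) (lorentz_self_pos.2 hR)).ne'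
  have hnonneg (X Y Z : ℂ) : 0 ≤ Real.sinh (kleinDist X Y) * Real.sinh (lineDist X Y Z) :=
    mul_nonneg (Real.sinh_nonneg_iff.2 (kleinDist_nonneg X Y))
      (Real.sinh_nonneg_iff.2 (lineDist_nonneg X Y Z))
  have hPQR := sinh_kleinDist_mul_sinh_lineDist_sq hP hQ hR hPQ
  have hQRP := sinh_kleinDist_mul_sinh_lineDist_sq hQ hR hP hQR
  rw [mul_rotate, mul_rotate, twiceArea_rotate, ← hPQR] at hQRP
  exact (sq_eq_sq₀ (hnonneg Q R P) (hnonneg P Q R)).1 (mul_right_cancel₀ hlorentz hQRP)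

theorem Delta_comm (n : ℕ) (P Q : ℂ) : Delta n P Q = Delta n Q P := by
  rw [Delta, kleinDist_comm, Delta]

section Delta

variable {n : ℕ} {P Q : ℂ} (h : 0 < n * kleinDist P Q) (y : ℝ)
include h

theorem exp_Delta : Real.exp (Delta n P Q) =
    (Real.exp (n * kleinDist P Q) + 1) / (Real.exp (n * kleinDist P Q) - 1) := by
  have hexp := Real.one_lt_exp_iff.2 h
  exact Real.exp_log (div_pos (by linarith) (by linarith))

theorem sinh_Delta : Real.sinh (Delta n P Q) = (Real.sinh (n * kleinDist P Q))⁻¹ := by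
  have hexp := Real.one_lt_exp_iff.2 h
  have hsub : Real.exp (n * kleinDist P Q) - 1 ≠ 0 := by linarith
  have hadd : Real.exp (n * kleinDist P Q) + 1 ≠ 0 := by linarith
  have hsq : Real.exp (n * kleinDist P Q) ^ 2 - 1 ≠ 0 := by
    rw [show Real.exp (n * kleinDist P Q) ^ 2 - 1 =
      (Real.exp (n * kleinDist P Q) + 1) * (Real.exp (n * kleinDist P Q) - 1) by ring]
    exact mul_ne_zero hadd hsub
  rw [Real.sinh_eq, Real.exp_neg, exp_Delta h, Real.sinh_eq, Real.exp_neg]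
  field_simp
  ring

theorem Delta_le_iff : Delta n P Q ≤ y ↔ 1 ≤ Real.sinh (n * kleinDist P Q) * Real.sinh y := by
  rw [← Real.sinh_le_sinh, sinh_Delta h, inv_le_iff_one_le_mul₀' (Real.sinh_pos_iff.2 h)]

theorem le_Delta_iff : y ≤ Delta n P Q ↔ Real.sinh (n * kleinDist P Q) * Real.sinh y ≤ 1 := by
  rw [← Real.sinh_le_sinh, sinh_Delta h, ← one_div, le_div_iff₀' (Real.sinh_pos_iff.2 h)]

theorem exp_mul_sinh_sub_cosh : Real.exp (n * kleinDist P Q) * Real.sinh y - Real.cosh y =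
    (Real.exp (n * kleinDist P Q) - 1) * Real.exp (-y) / 2 *
      (Real.exp (2 * y) - Real.exp (Delta n P Q)) := by
  have hsub : Real.exp (n * kleinDist P Q) - 1 ≠ 0 := (sub_pos.2 (Real.one_lt_exp_iff.2 h)).ne'
  rw [exp_Delta h, Real.sinh_eq, Real.cosh_eq, two_mul, Real.exp_add, Real.exp_neg]
  field_simp
  ring

theorem two_mul_le_Delta_iff :
    2 * y ≤ Delta n P Q ↔ Real.exp (n * kleinDist P Q) * Real.sinh y ≤ Real.cosh y := by
  have hsub := sub_pos.2 (Real.one_lt_exp_iff.2 h)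
  rw [← sub_nonneg (a := Real.cosh y), ← neg_sub, exp_mul_sinh_sub_cosh h, ← mul_neg, neg_sub,
    mul_nonneg_iff_of_pos_left (by positivity), sub_nonneg, Real.exp_le_exp]

theorem Delta_le_two_mul_iff :
    Delta n P Q ≤ 2 * y ↔ Real.cosh y ≤ Real.exp (n * kleinDist P Q) * Real.sinh y := by
  have hsub := sub_pos.2 (Real.one_lt_exp_iff.2 h)
  rw [← sub_nonneg (b := Real.cosh y), exp_mul_sinh_sub_cosh h,
    mul_nonneg_iff_of_pos_left (by positivity), sub_nonneg, Real.exp_le_exp]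

end Delta

theorem exp_mul_sinh_lineDist_nonneg (P Q R : ℂ) :
    0 ≤ Real.exp (kleinDist P Q) * Real.sinh (lineDist P Q R) :=
  mul_nonneg (Real.exp_pos _).le (Real.sinh_nonneg_iff.2 (lineDist_nonneg P Q R))

namespace ChordFrame

variable {P Q R : ℂ} {a b p q : ℝ} (h : ChordFrame P Q a b p q) (hR : ‖R‖ < 1)
include h hR

theorem mul_lorentz_pos : 0 < p * (1 - q) * (cross (spin a) (spin b) ^ 2 * lorentz R R) :=
  mul_pos (mul_pos h.pos (sub_pos.2 h.lt_one))
    (mul_pos (pow_pos h.cross_pos 2) (lorentz_pos hR hR.le))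

theorem exp_mul_sinh_lineDist_sq :
    (Real.exp (kleinDist P Q) * Real.sinh (lineDist P Q R)) ^ 2 *
      (p * (1 - q) * (cross (spin a) (spin b) ^ 2 * lorentz R R)) =
        q * (1 - p) * cross (spin b) (spinMap R (spin a)) ^ 2 := by
  have hpq : p * (1 - q) ≠ 0 := (mul_pos h.pos (sub_pos.2 h.lt_one)).ne'
  have hexp := h.exp_two_mul_kleinDist
  rw [eq_div_iff hpq, two_mul, Real.exp_add] at hexp
  rw [← h.sinh_lineDist_sq hR, ← hexp]
  ring

theorem cosh_lineDist_sq_mul : Real.cosh (lineDist P Q R) ^ 2 *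
      (p * (1 - q) * (cross (spin a) (spin b) ^ 2 * lorentz R R)) =
        p * (1 - q) * (lorentz R (spin a ^ 2) * lorentz R (spin b ^ 2)) := by
  rw [← h.cosh_lineDist_sq hR]
  ring

theorem two_mul_lineDist_le_Delta_one_iff : 2 * lineDist P Q R ≤ Delta 1 P Q ↔
    q * (1 - p) * cross (spin b) (spinMap R (spin a)) ^ 2 ≤
      p * (1 - q) * (lorentz R (spin a ^ 2) * lorentz R (spin b ^ 2)) := by
  rw [two_mul_le_Delta_iff (by simpa using h.kleinDist_pos), Nat.cast_one, one_mul,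
    ← sq_le_sq₀ (exp_mul_sinh_lineDist_nonneg P Q R) (Real.cosh_pos _).le,
    ← mul_le_mul_iff_left₀ (h.mul_lorentz_pos hR), h.exp_mul_sinh_lineDist_sq hR,
    h.cosh_lineDist_sq_mul hR]

theorem Delta_one_le_two_mul_lineDist_iff : Delta 1 P Q ≤ 2 * lineDist P Q R ↔
    p * (1 - q) * (lorentz R (spin a ^ 2) * lorentz R (spin b ^ 2)) ≤
      q * (1 - p) * cross (spin b) (spinMap R (spin a)) ^ 2 := by
  rw [Delta_le_two_mul_iff (by simpa using h.kleinDist_pos), Nat.cast_one, one_mul,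
    ← sq_le_sq₀ (Real.cosh_pos _).le (exp_mul_sinh_lineDist_nonneg P Q R),
    ← mul_le_mul_iff_left₀ (h.mul_lorentz_pos hR), h.exp_mul_sinh_lineDist_sq hR,
    h.cosh_lineDist_sq_mul hR]

end ChordFrame

theorem sinh_two_mul_kleinDist_mul_sinh_lineDist_sq {P Q R : ℂ} (hP : ‖P‖ < 1) (hQ : ‖Q‖ < 1)
    (hR : ‖R‖ < 1) (hPQ : P ≠ Q) :
    (Real.sinh (2 * kleinDist P Q) * Real.sinh (lineDist P Q R)) ^ 2 *
      (lorentz P P ^ 2 * lorentz Q Q ^ 2 * lorentz R R) =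
        4 * (lorentz P Q * twiceArea P Q R) ^ 2 := by
  rw [mul_pow (lorentz P Q), ← cosh_kleinDist_sq hP hQ,
    ← sinh_kleinDist_mul_sinh_lineDist_sq hP hQ hR hPQ, Real.sinh_two_mul]
  ring

theorem lorentz_le_of_Delta_two_le {P Q R : ℂ} (hP : ‖P‖ < 1) (hQ : ‖Q‖ < 1) (hR : ‖R‖ < 1)
    (hPQ : P ≠ Q) (h : Delta 2 P Q ≤ lineDist P Q R) :
    lorentz P P ^ 2 * lorentz Q Q ^ 2 * lorentz R R ≤ 4 * (lorentz P Q * twiceArea P Q R) ^ 2 := by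
  have hd := kleinDist_pos hP hQ hPQ
  rw [Delta_le_iff (by positivity), Nat.cast_ofNat] at h
  rw [← sinh_two_mul_kleinDist_mul_sinh_lineDist_sq hP hQ hR hPQ]
  have := lorentz_self_pos.2 hP
  have := lorentz_self_pos.2 hQ
  have := lorentz_self_pos.2 hR
  exact le_mul_of_one_le_left (by positivity) (one_le_pow₀ h)

theorem two_mul_lineDist_le_Delta_one_rotate {P Q R : ℂ} (hP : ‖P‖ < 1) (hQ : ‖Q‖ < 1)
    (hR : ‖R‖ < 1) (hPQ : P ≠ Q) (hQR : Q ≠ R) (h : lineDist P Q R ≤ Delta 2 P Q) :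
    2 * lineDist Q R P ≤ Delta 1 Q R := by
  have hd := kleinDist_pos hP hQ hPQ
  have hd' := kleinDist_pos hQ hR hQR
  have hle : lineDist Q R P ≤ kleinDist P Q :=
    lineDist_le_kleinDist (left_mem_affineSpan_pair ..) hQ
  have hcosh : Real.cosh (lineDist Q R P) ≤ Real.cosh (kleinDist P Q) := by
    rwa [Real.cosh_le_cosh, abs_of_nonneg (lineDist_nonneg _ _ _), abs_of_pos hd]
  rw [le_Delta_iff (by positivity), Nat.cast_ofNat, Real.sinh_two_mul] at h
  rw [le_Delta_iff (by simpa using hd'), Nat.cast_one, one_mul, Real.sinh_two_mul]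
  have hsinh := mul_nonneg (Real.sinh_nonneg_iff.2 hd'.le)
    (Real.sinh_nonneg_iff.2 (lineDist_nonneg Q R P))
  calc
    _ = 2 * (Real.sinh (kleinDist Q R) * Real.sinh (lineDist Q R P)) *
        Real.cosh (lineDist Q R P) := by ring
    _ ≤ 2 * (Real.sinh (kleinDist Q R) * Real.sinh (lineDist Q R P)) *
        Real.cosh (kleinDist P Q) := by gcongr
    _ = 2 * Real.sinh (kleinDist P Q) * Real.cosh (kleinDist P Q) *
        Real.sinh (lineDist P Q R) := by
      rw [sinh_kleinDist_mul_sinh_lineDist_rotate hP hQ hR hPQ hQR]; ring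
    _ ≤ 1 := h

/-! ### Traces and determinants of products of chord maps -/

theorem exists_pos_hasEigenvalue {V : Type*} [AddCommGroup V] [Module ℝ V]
    (hV : Module.finrank ℝ V = 2) {f : Module.End ℝ V} (htr : 0 < LinearMap.trace ℝ V f)
    (hdisc : 4 * LinearMap.det f ≤ LinearMap.trace ℝ V f ^ 2) :
    ∃ μ > 0, f.HasEigenvalue μ := by
  have : FiniteDimensional ℝ V := .of_finrank_pos (by rw [hV]; norm_num)
  have hsqrt := Real.sq_sqrt (sub_nonneg.2 hdisc)
  refine ⟨(LinearMap.trace ℝ V f + √(LinearMap.trace ℝ V f ^ 2 - 4 * LinearMap.det f)) / 2,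
    by positivity, ?_⟩
  let b := Module.finBasisOfFinrankEq ℝ V hV
  rw [Module.End.hasEigenvalue_iff_isRoot_charpoly, ← f.charpoly_toMatrix b,
    Matrix.charpoly_fin_two, ← LinearMap.trace_eq_matrix_trace, LinearMap.det_toMatrix,
    Polynomial.IsRoot]
  simp only [Polynomial.eval_add, Polynomial.eval_sub, Polynomial.eval_pow, Polynomial.eval_mul,
    Polynomial.eval_X, Polynomial.eval_C]
  linear_combination hsqrt / 4

theorem spinMap_mul_spinMap_add (X Y : ℂ) :
    spinMap X * spinMap Y + spinMap Y * spinMap X = -(2 * lorentz X Y) • (1 : Module.End ℝ ℂ) := by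
  refine LinearMap.ext fun z => Complex.ext ?_ ?_ <;>
    simp [spinMap_re, spinMap_im, lorentz_eq] <;> ring

theorem spinMap_mul_self (X : ℂ) :
    spinMap X * spinMap X = -lorentz X X • (1 : Module.End ℝ ℂ) :=
  LinearMap.ext fun z => (spinMap_spinMap X z).trans (neg_smul _ _).symm

theorem det_spinMap (X : ℂ) : LinearMap.det (spinMap X) = lorentz X X := by
  rw [← LinearMap.det_toMatrix Complex.basisOneI, Matrix.det_fin_two]
  simp [LinearMap.toMatrix_apply, spinMap_re, spinMap_im, lorentz_eq]; ring

theorem trace_spinMap (X : ℂ) : LinearMap.trace ℝ ℂ (spinMap X) = 0 := by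
  rw [LinearMap.trace_eq_matrix_trace ℝ Complex.basisOneI, Matrix.trace_fin_two]
  simp [LinearMap.toMatrix_apply, spinMap_re, spinMap_im]

theorem trace_spinMap_mul (P Q R : ℂ) :
    LinearMap.trace ℝ ℂ (spinMap R * (spinMap Q * spinMap P)) = -(2 * twiceArea P Q R) := by
  rw [LinearMap.trace_eq_matrix_trace ℝ Complex.basisOneI, Matrix.trace_fin_two]
  simp [LinearMap.toMatrix_apply, spinMap_re, spinMap_im, twiceArea, cross]
  ring

theorem spinMap_mul_spinMap_sq (P Q : ℂ) : (spinMap Q * spinMap P) ^ 2 =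
    -(2 * lorentz P Q) • (spinMap Q * spinMap P) -
      (lorentz P P * lorentz Q Q) • (1 : Module.End ℝ ℂ) := by
  have hPQ : spinMap P * spinMap Q =
      -(2 * lorentz P Q) • (1 : Module.End ℝ ℂ) - spinMap Q * spinMap P :=
    eq_sub_of_add_eq (spinMap_mul_spinMap_add P Q)
  calc
    _ = spinMap Q * (spinMap P * spinMap Q) * spinMap P := by noncomm_ring
    _ = -(2 * lorentz P Q) • (spinMap Q * spinMap P) -
        spinMap Q * spinMap Q * (spinMap P * spinMap P) := by
      rw [hPQ]
      simp only [mul_sub, sub_mul, mul_smul_comm, smul_mul_assoc, mul_one, mul_assoc]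
    _ = _ := by
      rw [spinMap_mul_self, spinMap_mul_self, smul_mul_smul_comm, one_mul, neg_mul_neg,
        mul_comm (lorentz Q Q)]

theorem trace_spinMap_mul_sq (P Q R : ℂ) :
    LinearMap.trace ℝ ℂ (spinMap R * (spinMap Q * spinMap P) ^ 2) =
      4 * (lorentz P Q * twiceArea P Q R) := by
  rw [spinMap_mul_spinMap_sq, mul_sub, mul_smul_comm, mul_smul_comm, mul_one, map_sub, map_smul,
    map_smul, trace_spinMap, trace_spinMap_mul]
  simp only [smul_eq_mul]
  ring

theorem det_spinMap_mul_sq (P Q R : ℂ) :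
    LinearMap.det (spinMap R * (spinMap Q * spinMap P) ^ 2) =
      lorentz P P ^ 2 * lorentz Q Q ^ 2 * lorentz R R := by
  simp only [map_mul, map_pow, det_spinMap]
  ring

/-! ### The orbit of a triangle -/

theorem map_lt_add_of_map_eq (f : CircleDeg1Lift) {a : ℝ} {k : ℤ} (h : f a = a + k) (t : ℝ) :
    f t < t + (k + 1) := by
  have hτ : f.translationNumber < (k + 1 : ℤ) := by
    rw [f.translationNumber_of_eq_add_int h]
    exact_mod_cast lt_add_one k
  exact_mod_cast f.map_lt_of_translationNumber_lt_int hτ t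

section TangentLift

variable {U : Set ℂ} (hc : IsCompact U) (hU : U ⊆ Metric.ball 0 1) {X : ℂ} (hX : X ∈ U) {t : ℝ}
include hc hU hX

theorem tangentLift_le_chordLift : tangentLift U t ≤ chordLift X t :=
  (isLeast_tangentLift hc hU ⟨X, hX⟩ t).2 (Set.mem_image_of_mem _ hX)

theorem tangentLift_eq_chordLift (h : ∀ Y ∈ U, chordLift X t ≤ chordLift Y t) :
    tangentLift U t = chordLift X t :=
  (isLeast_tangentLift hc hU ⟨X, hX⟩ t).unique
    ⟨Set.mem_image_of_mem _ hX, Set.forall_mem_image.2 h⟩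

end TangentLift

theorem triple_subset_ball {P Q R : ℂ} (hP : ‖P‖ < 1) (hQ : ‖Q‖ < 1) (hR : ‖R‖ < 1) :
    ({P, Q, R} : Set ℂ) ⊆ Metric.ball 0 1 := by
  rintro X (rfl | rfl | rfl)
  exacts [mem_ball_zero_iff.2 hP, mem_ball_zero_iff.2 hQ, mem_ball_zero_iff.2 hR]

theorem isCompact_triple (P Q R : ℂ) : IsCompact ({P, Q, R} : Set ℂ) :=
  (Set.toFinite _).isCompact

theorem tangentLift_triple_eq {P Q R X : ℂ} {t : ℝ} (hP : ‖P‖ < 1) (hQ : ‖Q‖ < 1) (hR : ‖R‖ < 1)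
    (hX : X ∈ ({P, Q, R} : Set ℂ)) (hXP : chordLift X t ≤ chordLift P t)
    (hXQ : chordLift X t ≤ chordLift Q t) (hXR : chordLift X t ≤ chordLift R t) :
    tangentLift {P, Q, R} t = chordLift X t := by
  refine tangentLift_eq_chordLift (isCompact_triple P Q R) (triple_subset_ball hP hQ hR) hX ?_
  rintro Y (rfl | rfl | rfl)
  exacts [hXP, hXQ, hXR]

namespace ChordFrame

variable {P Q R : ℂ} {a b p q : ℝ} (h : ChordFrame P Q a b p q)
include h

theorem chordLift_left_start : chordLift P a = b := by
  have hspin : HasDirection (spinMap P (spin a)) b := by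
    have hr : 0 < 2 * p * cross (spin a) (spin b) :=
      mul_pos (mul_pos two_pos h.pos) h.cross_pos
    refine ⟨_, hr, ?_⟩
    rw [h.left_eq, spinMap_chordPoint, cross_self, cross_anticomm (spin b)]
    module
  have hP := h.norm_left_lt_one
  refine (hasDirection_chordLift hP).eq_of_cross_eq_zero hspin ?_ ?_ ?_
  · linarith [chordLift_lt_add_one P a, h.lt]
  · linarith [lt_chordLift P a, h.lt_add_one]
  · exact cross_self _

theorem chordLift_right_start : chordLift Q a = b := by
  have hQ := h.norm_right_lt_one
  have hb := h.reverse.chordLift_left_start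
  rw [← chordLift_chordLift hQ] at hb
  exact ((strictMono_chordLift hQ).injective hb).symm

theorem chordLift_left_end : chordLift P b = a + 1 := by
  rw [← h.chordLift_left_start, chordLift_chordLift h.norm_left_lt_one]

theorem chordLift_right_end : chordLift Q b = a + 1 := by
  rw [← h.chordLift_right_start, chordLift_chordLift h.norm_right_lt_one]

theorem chordLift_left_le_chordLift_right {t : ℝ} (ht : t ∈ Set.Ioo b (a + 1)) :
    chordLift P t ≤ chordLift Q t := by
  have hP := hasDirection_chordLift (t := t) h.norm_left_lt_one
  have hQ := hasDirection_chordLift (t := t) h.norm_right_lt_one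
  refine hP.le_of_cross_nonneg hQ ?_ ?_
  · linarith [chordLift_lt_add_one P t, lt_chordLift Q t]
  · have hat := cross_spin_spin_pos (h.lt.trans ht.1) ht.2
    have hbt := cross_spin_spin_pos ht.1 (by linarith [ht.2, h.lt])
    have hcross : cross (spinMap P (spin t)) (spinMap Q (spin t)) =
        4 * cross (spin a) (spin b) * (q - p) * (cross (spin a) (spin t) *
          cross (spin b) (spin t)) := by
      rw [h.left_eq, h.right_eq, cross_spinMap_chordPoint]
      ring
    rw [hcross]
    have := h.cross_pos
    have := sub_pos.2 h.param_lt
    positivity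

theorem chordLift_right_le_chordLift_left {t : ℝ} (ht : t ∈ Set.Ioo (a + 1) (b + 1)) :
    chordLift Q t ≤ chordLift P t :=
  h.reverse.chordLift_left_le_chordLift_right ht

end ChordFrame

section Triangle

variable {P Q R : ℂ} (hP : ‖P‖ < 1) (hQ : ‖Q‖ < 1) (hR : ‖R‖ < 1) (hPQ : P ≠ Q)
include hP hQ

include hPQ in
theorem chordLift_comp_lt (t : ℝ) :
    chordLift Q (chordLift P (chordLift Q (chordLift P t))) < t + 3 := by
  obtain ⟨a, b, p, q, h⟩ := exists_chordFrame hP hQ hPQ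
  have hP := strictMono_chordLift hP
  have hQ := strictMono_chordLift hQ
  let f : CircleDeg1Lift := ⟨⟨fun t => chordLift Q (chordLift P (chordLift Q (chordLift P t))),
    (hQ.comp (hP.comp (hQ.comp hP))).monotone⟩, fun t => by simp only [chordLift_add_one]⟩
  have hfa : f a = a + (2 : ℤ) := by
    change chordLift Q (chordLift P (chordLift Q (chordLift P a))) = _
    rw [h.chordLift_left_start, h.chordLift_right_end, chordLift_add_one, h.chordLift_left_start,
      chordLift_add_one, h.chordLift_right_end, add_assoc, one_add_one_eq_two, Int.cast_ofNat]
  exact (map_lt_add_of_map_eq f hfa t).trans_eq (by norm_num)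

include hR

theorem iterate_tangentLift_le_chordLift (t : ℝ) : (tangentLift {P, Q, R})^[5] t ≤
    chordLift R (chordLift Q (chordLift P (chordLift Q (chordLift P t)))) := by
  have hmono := (strictMono_tangentLift (isCompact_triple P Q R) (triple_subset_ball hP hQ hR)
    (Set.insert_nonempty _ _)).monotone
  have hle {X t} (hX) := tangentLift_le_chordLift (isCompact_triple P Q R)
    (triple_subset_ball hP hQ hR) (X := X) (t := t) hX
  refine (hle (X := R) (by simp)).trans' (hmono ?_)
  refine (hle (X := Q) (by simp)).trans' (hmono ?_)
  refine (hle (X := P) (by simp)).trans' (hmono ?_)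
  refine (hle (X := Q) (by simp)).trans' (hmono ?_)
  exact hle (by simp)

include hPQ

theorem exists_chordLift_comp_eq (harea : 0 < twiceArea P Q R)
    (h : lorentz P P ^ 2 * lorentz Q Q ^ 2 * lorentz R R ≤
      4 * (lorentz P Q * twiceArea P Q R) ^ 2) :
    ∃ t, chordLift R (chordLift Q (chordLift P (chordLift Q (chordLift P t)))) = t + 2 := by
  have htrace : 0 < 4 * (lorentz P Q * twiceArea P Q R) := by
    have := lorentz_pos hP hQ.le
    positivity
  obtain ⟨μ, hμ, hN⟩ := exists_pos_hasEigenvalue finrank_real_complex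
    (f := spinMap R * (spinMap Q * spinMap P) ^ 2) (by rwa [trace_spinMap_mul_sq])
    (by rw [trace_spinMap_mul_sq, det_spinMap_mul_sq]; linarith)
  obtain ⟨z, hz⟩ := hN.exists_hasEigenvector
  obtain ⟨t, ht⟩ := exists_hasDirection hz.2
  have hNt := ((((ht.spinMap hP).spinMap hQ).spinMap hP).spinMap hQ).spinMap hR
  obtain ⟨n, hn⟩ := hNt.exists_eq_add_two_mul (hz.apply_eq_smul ▸ ht.smul hμ)
  refine ⟨t, ?_⟩
  have hlt := chordLift_comp_lt hP hQ hPQ t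
  have hn0 : 0 < n := by
    have h1 := lt_chordLift P t
    have h2 := lt_chordLift Q (chordLift P t)
    have h3 := lt_chordLift P (chordLift Q (chordLift P t))
    have h4 := lt_chordLift Q (chordLift P (chordLift Q (chordLift P t)))
    have h5 := lt_chordLift R (chordLift Q (chordLift P (chordLift Q (chordLift P t))))
    have : (0 : ℝ) < n := by linarith
    exact_mod_cast this
  have hn2 : n < 2 := by
    have := chordLift_lt_add_one R (chordLift Q (chordLift P (chordLift Q (chordLift P t))))
    have : (n : ℝ) < 2 := by linarith
    exact_mod_cast this
  obtain rfl : n = 1 := by omega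
  rw [hn, Int.cast_one, mul_one]

theorem exists_iterate_tangentLift_le_of_Delta_two_le (harea : 0 < twiceArea P Q R)
    (h : Delta 2 P Q ≤ lineDist P Q R) : ∃ t, (tangentLift {P, Q, R})^[5] t ≤ t + 2 := by
  obtain ⟨t, ht⟩ := exists_chordLift_comp_eq hP hQ hR hPQ harea
    (lorentz_le_of_Delta_two_le hP hQ hR hPQ h)
  exact ⟨t, ht ▸ iterate_tangentLift_le_chordLift hP hQ hR t⟩

end Triangle

namespace ChordFrame

variable {P Q R : ℂ} {a b p q : ℝ} (h : ChordFrame P Q a b p q) (hR : ‖R‖ < 1)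
include h hR

section

variable (harea : 0 < twiceArea P Q R)
include harea

theorem lt_chordLift_start : b < chordLift R a := by
  have hcross : 0 < cross (spin b) (spinMap R (spin a)) := by
    rw [h.twiceArea_eq] at harea
    have := h.cross_pos
    have := sub_pos.2 h.param_lt
    exact pos_of_mul_pos_right harea (by positivity)
  exact (hasDirection_spin b).lt_of_cross_pos (hasDirection_chordLift hR)
    (by linarith [h.lt_add_one, lt_chordLift R a]) hcross

theorem chordLift_end_lt : chordLift R b < a + 1 := by
  rw [← chordLift_chordLift hR]
  exact strictMono_chordLift hR (h.lt_chordLift_start hR harea)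

theorem chordLift_chordLift_start_mem :
    chordLift Q (chordLift R a) ∈ Set.Ioo (a + 1) (b + 1) := by
  have hQ := strictMono_chordLift h.norm_right_lt_one
  rw [← h.chordLift_right_end, ← h.chordLift_right_start, ← chordLift_add_one,
    h.chordLift_right_start]
  exact ⟨hQ (h.lt_chordLift_start hR harea), hQ (chordLift_lt_add_one R a)⟩

theorem chordLift_chordLift_end_mem : chordLift P (chordLift R b) ∈ Set.Ioo (a + 1) (b + 1) := by
  have hP := strictMono_chordLift h.norm_left_lt_one
  rw [← h.chordLift_left_end, ← h.chordLift_left_start, ← chordLift_add_one,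
    h.chordLift_left_start]
  exact ⟨hP (lt_chordLift R b), hP (h.chordLift_end_lt hR harea)⟩

theorem tangentLift_start : tangentLift {P, Q, R} a = b := by
  rw [← h.chordLift_left_start]
  refine tangentLift_triple_eq h.norm_left_lt_one h.norm_right_lt_one hR (by simp) le_rfl ?_ ?_ <;>
    rw [h.chordLift_left_start]
  · exact h.chordLift_right_start.ge
  · exact (h.lt_chordLift_start hR harea).le

theorem tangentLift_end : tangentLift {P, Q, R} b = chordLift R b := by
  refine tangentLift_triple_eq h.norm_left_lt_one h.norm_right_lt_one hR (by simp) ?_ ?_ le_rfl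
  · exact h.chordLift_left_end ▸ (h.chordLift_end_lt hR harea).le
  · exact h.chordLift_right_end ▸ (h.chordLift_end_lt hR harea).le

theorem tangentLift_chordLift_start : tangentLift {P, Q, R} (chordLift R a) = a + 1 := by
  have hRa := h.lt_chordLift_start hR harea
  rw [← chordLift_chordLift hR]
  refine tangentLift_triple_eq h.norm_left_lt_one h.norm_right_lt_one hR (by simp) ?_ ?_ le_rfl <;>
    rw [chordLift_chordLift hR]
  · exact h.chordLift_left_end ▸ (strictMono_chordLift h.norm_left_lt_one hRa).le
  · exact h.chordLift_right_end ▸ (strictMono_chordLift h.norm_right_lt_one hRa).le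

theorem tangentLift_chordLift_end :
    tangentLift {P, Q, R} (chordLift R b) = chordLift P (chordLift R b) := by
  refine tangentLift_triple_eq h.norm_left_lt_one h.norm_right_lt_one hR (by simp) le_rfl ?_ ?_
  · exact h.chordLift_left_le_chordLift_right ⟨lt_chordLift R b, h.chordLift_end_lt hR harea⟩
  · rw [chordLift_chordLift hR]
    exact (h.chordLift_chordLift_end_mem hR harea).2.le

theorem tangentLift_chordLift_chordLift_start :
    tangentLift {P, Q, R} (chordLift Q (chordLift R a)) = chordLift R a + 1 := by
  have hmem := h.chordLift_chordLift_start_mem hR harea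
  rw [← chordLift_chordLift h.norm_right_lt_one]
  refine tangentLift_triple_eq h.norm_left_lt_one h.norm_right_lt_one hR (by simp) ?_ le_rfl ?_
  · exact h.chordLift_right_le_chordLift_left hmem
  · rw [chordLift_chordLift h.norm_right_lt_one, ← chordLift_add_one]
    exact (strictMono_chordLift hR hmem.1).le

theorem iterate_tangentLift : (tangentLift {P, Q, R})^[5] (chordLift Q (chordLift R a)) =
    chordLift P (chordLift R b) + 2 := by
  simp only [Function.iterate_succ_apply, Function.iterate_zero_apply, tangentLift_add_one,
    h.tangentLift_chordLift_chordLift_start hR harea, h.tangentLift_chordLift_start hR harea,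
    h.tangentLift_start hR harea, h.tangentLift_end hR harea,
    h.tangentLift_chordLift_end hR harea]
  ring

end

omit hR in
theorem cross_spinMap_comp :
    cross (spinMap Q (spinMap R (spin a))) (spinMap P (spinMap R (spin b))) =
      4 * cross (spin a) (spin b) *
        (p * (1 - q) * (lorentz R (spin a ^ 2) * lorentz R (spin b ^ 2)) -
          q * (1 - p) * cross (spin b) (spinMap R (spin a)) ^ 2) := by
  rw [h.left_eq, h.right_eq, cross_spinMap_chordPoint, cross_spin_spinMap_spin,
    cross_spin_spinMap_spin, cross_spinMap_comm R (spin a) (spin b)]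
  ring

theorem hasDirection_chordLift_chordLift_start :
    HasDirection (spinMap Q (spinMap R (spin a))) (chordLift Q (chordLift R a)) :=
  (hasDirection_chordLift hR).spinMap h.norm_right_lt_one

theorem hasDirection_chordLift_chordLift_end :
    HasDirection (spinMap P (spinMap R (spin b))) (chordLift P (chordLift R b)) :=
  (hasDirection_chordLift hR).spinMap h.norm_left_lt_one

variable (harea : 0 < twiceArea P Q R)
include harea

theorem chordLift_chordLift_start_le (hδ : 2 * lineDist P Q R ≤ Delta 1 P Q) :
    chordLift Q (chordLift R a) ≤ chordLift P (chordLift R b) := by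
  refine (h.hasDirection_chordLift_chordLift_start hR).le_of_cross_nonneg
    (h.hasDirection_chordLift_chordLift_end hR) ?_ ?_
  · linarith [(h.chordLift_chordLift_start_mem hR harea).2,
      (h.chordLift_chordLift_end_mem hR harea).1, h.lt_add_one]
  · rw [h.cross_spinMap_comp]
    exact mul_nonneg (mul_pos four_pos h.cross_pos).le
      (sub_nonneg.2 ((h.two_mul_lineDist_le_Delta_one_iff hR).1 hδ))

theorem chordLift_chordLift_end_le (hδ : Delta 1 P Q ≤ 2 * lineDist P Q R) :
    chordLift P (chordLift R b) ≤ chordLift Q (chordLift R a) := by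
  refine (h.hasDirection_chordLift_chordLift_end hR).le_of_cross_nonneg
    (h.hasDirection_chordLift_chordLift_start hR) ?_ ?_
  · linarith [(h.chordLift_chordLift_start_mem hR harea).1,
      (h.chordLift_chordLift_end_mem hR harea).2, h.lt_add_one]
  · rw [cross_anticomm, h.cross_spinMap_comp, ← mul_neg, neg_sub]
    exact mul_nonneg (mul_pos four_pos h.cross_pos).le
      (sub_nonneg.2 ((h.Delta_one_le_two_mul_lineDist_iff hR).1 hδ))

end ChordFrame

section Triangle

variable {P Q R : ℂ} (hP : ‖P‖ < 1) (hQ : ‖Q‖ < 1) (hR : ‖R‖ < 1) (hPQ : P ≠ Q)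
  (harea : 0 < twiceArea P Q R)
include hP hQ hR hPQ harea

theorem exists_iterate_tangentLift_le_of_Delta_one_le (h : Delta 1 P Q ≤ 2 * lineDist P Q R) :
    ∃ t, (tangentLift {P, Q, R})^[5] t ≤ t + 2 := by
  obtain ⟨a, b, p, q, hf⟩ := exists_chordFrame hP hQ hPQ
  exact ⟨_, (hf.iterate_tangentLift hR harea).trans_le
    (add_le_add_left (hf.chordLift_chordLift_end_le hR harea h) 2)⟩

theorem exists_le_iterate_tangentLift_of_le_Delta_one (h : 2 * lineDist P Q R ≤ Delta 1 P Q) :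
    ∃ t, t + 2 ≤ (tangentLift {P, Q, R})^[5] t := by
  obtain ⟨a, b, p, q, hf⟩ := exists_chordFrame hP hQ hPQ
  exact ⟨_, (add_le_add_left (hf.chordLift_chordLift_start_le hR harea h) 2).trans_eq
    (hf.iterate_tangentLift hR harea).symm⟩

theorem exists_le_iterate_tangentLift_of_le_Delta_two (hQR : Q ≠ R)
    (h : lineDist P Q R ≤ Delta 2 P Q) : ∃ t, t + 2 ≤ (tangentLift {P, Q, R})^[5] t := by
  have hrot : ({Q, R, P} : Set ℂ) = {P, Q, R} := by
    rw [Set.pair_comm R P, Set.insert_comm]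
  exact hrot ▸ exists_le_iterate_tangentLift_of_le_Delta_one hQ hR hP hQR
    ((twiceArea_rotate P Q R).symm ▸ harea)
    (two_mul_lineDist_le_Delta_one_rotate hP hQ hR hPQ hQR h)

end Triangle

end BarBilliard

end

open BarBilliard in
theorem theorem4p9 (P Q R : ℂ) (hP : ‖P‖ < 1) (hQ : ‖Q‖ < 1) (hR : ‖R‖ < 1)
    (hPQR : AffineIndependent ℝ ![P, Q, R])
    (h : (BarBilliard.Delta 2 P Q ≤ BarBilliard.lineDist P Q R ∧
            BarBilliard.lineDist P Q R ≤ 1 / 2 * BarBilliard.Delta 1 P Q) ∨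
         (1 / 2 * BarBilliard.Delta 1 P Q ≤ BarBilliard.lineDist P Q R ∧
            BarBilliard.lineDist P Q R ≤ BarBilliard.Delta 2 P Q)) :
    BarBilliard.HasRotationNumber
      (BarBilliard.psi (convexHull ℝ ({P, Q, R} : Set ℂ))) (2 / 5) := by
  wlog harea : 0 < twiceArea P Q R generalizing P Q
  · rw [Set.insert_comm]
    refine this Q P hQ hP hPQR.comm_left ?_ ?_
    · simpa only [Delta_comm, lineDist_comm] using h
    · rw [twiceArea_swap]
      exact neg_pos.2 ((not_lt.1 harea).lt_of_ne (twiceArea_ne_zero hPQR))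
  have hPQ : P ≠ Q := hPQR.injective.ne (show (0 : Fin 3) ≠ 1 by decide)
  have hQR : Q ≠ R := hPQR.injective.ne (show (1 : Fin 3) ≠ 2 by decide)
  have hc := isCompact_triple P Q R
  have hU := triple_subset_ball hP hQ hR
  have hne : ({P, Q, R} : Set ℂ).Nonempty := Set.insert_nonempty _ _
  rw [psi_convexHull hc hU hne]
  suffices (∃ t, t + 2 ≤ (tangentLift {P, Q, R})^[5] t) ∧
      ∃ t, (tangentLift {P, Q, R})^[5] t ≤ t + 2 by
    simpa only [Int.cast_ofNat, Nat.cast_ofNat] using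
      hasRotationNumber_of_iterate_crossing (n := 5) (k := 2)
        (isNormalizedLift_tangentLift hc hU hne) (by norm_num) (mod_cast this.1) (mod_cast this.2)
  rcases h with ⟨h₂, h₁⟩ | ⟨h₁, h₂⟩
  · exact ⟨exists_le_iterate_tangentLift_of_le_Delta_one hP hQ hR hPQ harea (by linarith),
      exists_iterate_tangentLift_le_of_Delta_two_le hP hQ hR hPQ harea h₂⟩
  · exact ⟨exists_le_iterate_tangentLift_of_le_Delta_two hP hQ hR hPQ harea hQR h₂,
      exists_iterate_tangentLift_le_of_Delta_one_le hP hQ hR hPQ harea (by linarith)⟩
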